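/- Let $B$, $C$, $D$ be unital $C^*$-algebras and let $Y$ be a $C$–$D$-equivalence bimodule, i.e. a full left Hilbert $C$-module with inner product ${}_C\langle\cdot,\cdot\rangle$ that is also a full right Hilbert $D$-module with inner product $\langle\cdot,\cdot\rangle_D$, with commuting actions satisfying $\langle c\cdot x,y\rangle_D=\langle x,c^*\cdot y\rangle_D$, ${}_C\langle x\cdot d,y\rangle={}_C\langle x,y\cdot d^*\rangle$ and ${}_C\langle x,y\rangle\cdot z=x\cdot\langle y,z\rangle_D$. Let $\{u_i\}_{i=1}^n\subset Y$ be a finite left $C$-basis, i.e. $y=\sum_{i=1}^n {}_C\langle y,u_i\rangle\cdot u_i$ for all $y\in Y$. Let $F$ be a right Hilbert $B$-module, $\mathbf B_B(F)$ the $C^*$-algebra of adjointable right $B$-module maps on $F$, and $\psi:D\to\mathbf B_B(F)$ a completely positive linear map. Identify $F\otimes\mathbb C^n$ with $\bigoplus_{1}^n F$ and $\mathbf B_B(F\otimes\mathbb C^n)$ with $M_n(\mathbf B_B(F))$, and put $$\phi(c)=\bigl[\psi(\langle u_i,\,c\cdot u_j\rangle_D)\bigr]_{i,j=1}^n\qquad(c\in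 C).$$ A minimal KSGNS-representation of a completely positive map $\theta:L\to\mathbf B_B(K)$ is a triple $(\pi_\theta,V_\theta,K_\theta)$ of a right Hilbert $B$-module $K_\theta$, a $*$-homomorphism $\pi_\theta:L\to\mathbf B_B(K_\theta)$ and an adjointable map $V_\theta\in\mathbf B_B(K,K_\theta)$ with $\theta(l)=V_\theta^*\pi_\theta(l)V_\theta$ for all $l\in L$ and $\overline{\operatorname{span}}\,\pi_\theta(L)V_\theta K=K_\theta$. Then: 1. $\phi$ is a completely positive linear map from $C$ to $\mathbf B_B(F\otimes\mathbb C^n)$. 2. $\phi$ is strongly Morita equivalent to $\psi$: there are minimal KSGNS-representations $(\pi_\phi,V_\phi,E_\phi)$ of $\phi$ and $(\pi_\psi,V_\psi,F_\psi)$ of $\psi$, both non-degenerate, a $C$–$D$-equivalence bimodule $Z$ and a linear map $\pi_Z:Z\to\mathbf B_B(F_\psi,E_\phi)$ with $\pi_Z(y)\pi_Z(z)^*=\pi_\phi({}_C\langle y,z\rangle)$, $\pi_Z(y)^*\pi_Z(z)=\pi_\psi(\langle y,z\rangle_D)$ and $\pi_Z(c\cdot y\cdot d)=\pi_\phi(c)\pi_Z(y)\pi_\psi(d)$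 for all $y,z\in Z$, $c\in C$, $d\in D$. 3. For every minimal KSGNS-representation $(\pi_\psi,V_\psi,F_\psi)$ of $\psi$, the interior tensor product $Y\otimes_D F_\psi$ (the right Hilbert $B$-module densely spanned by elements $y\otimes f$, bilinear in $y$ and $f$, with $\langle y\otimes f,z\otimes g\rangle_B=\langle f,\pi_\psi(\langle y,z\rangle_D)g\rangle_B$) exists and carries the induced representation $\pi_C(c)(y\otimes f)=(c\cdot y)\otimes f$ of $C$; and for every minimal KSGNS-representation $(\pi_\phi,V_\phi,E_\phi)$ of $\phi$, the representation $(\pi_\phi,E_\phi)$ is unitarily equivalent to $(\pi_C,Y\otimes_D F_\psi)$. -/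

import Mathlib

open scoped CStarAlgebra WithCStarModule

set_option linter.unusedSectionVars false

noncomputable section

namespace HilbertModule

/-! ### Conventions

Mathlib's `CStarModule A E` is a Hilbert `A`-module whose algebra acts on the left and whose inner
product is linear in the second variable, `inner x (a • y) = a * inner x y`.  Hence

* a right Hilbert `B`-module is a complete `CStarModule Bᵐᵒᵖ E`, the right action being
  `x · b = op b • x` and the `B`-valued inner product being `rightInner B x y` below;
* a left Hilbert `C`-module is a complete `CStarModule C E`, the `C`-valued inner product, linear
  in the first variable, being `leftInner C x y` below.

The module axioms follow from the axioms of the inner product, which is definite. -/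

section Inner

open MulOpposite

/-- The `B`-valued inner product `⟨x, y⟩_B` of a right Hilbert `B`-module, linear in `y`:
`⟨x, y · b⟩_B = ⟨x, y⟩_B b`. -/
abbrev rightInner (B : Type*) {E : Type*} [Inner Bᵐᵒᵖ E] (x y : E) : B :=
  unop (inner Bᵐᵒᵖ x y)

/-- The `C`-valued inner product `_C⟨x, y⟩` of a left Hilbert `C`-module, linear in `x`:
`_C⟨c · x, y⟩ = c _C⟨x, y⟩`. -/
abbrev leftInner (C : Type*) {E : Type*} [Inner C E] (x y : E) : C :=
  inner C y x

end Inner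

/-! ### Adjointable maps -/

section Adjointable

variable (A : Type*) [CStarAlgebra A] [PartialOrder A] [StarOrderedRing A]
variable (E : Type*) [NormedAddCommGroup E] [NormedSpace ℂ E] [SMul A E] [CStarModule A E]
variable (F : Type*) [NormedAddCommGroup F] [NormedSpace ℂ F] [SMul A F] [CStarModule A F]

/-- The space of bounded adjointable maps between Hilbert `A`-modules. (They are automatically
`A`-linear.) -/
def adjointable : Submodule ℂ (E →L[ℂ] F) where
  carrier := {T | ∃ S : F →L[ℂ] E, ∀ x y, inner A (T x) y = inner A x (S y)}
  add_mem' := by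
    rintro T T' ⟨S, hS⟩ ⟨S', hS'⟩
    exact ⟨S + S', fun x y => by simp [hS, hS']⟩
  zero_mem' := ⟨0, fun x y => by simp⟩
  smul_mem' := by
    rintro z T ⟨S, hS⟩
    exact ⟨star z • S, fun x y => by simp [hS]⟩

variable {A E F}

lemma eq_of_inner_eq {x y : E} (h : ∀ z : E, inner A z x = inner A z y) : x = y := by
  rw [← sub_eq_zero, ← CStarModule.inner_self (A := A), CStarModule.inner_sub_right, h, sub_self]

/-- The adjoint of an adjointable map. -/
def adjoint (T : adjointable A E F) : adjointable A F E :=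
  ⟨T.2.choose, T.1, fun x y => by
    rw [← CStarModule.star_inner, ← T.2.choose_spec, CStarModule.star_inner]⟩

lemma inner_adjoint (T : adjointable A E F) (x : E) (y : F) :
    inner A ((T : E →L[ℂ] F) x) y = inner A x ((adjoint T : F →L[ℂ] E) y) :=
  T.2.choose_spec x y

lemma adjoint_eq {T : adjointable A E F} {S : F →L[ℂ] E}
    (h : ∀ x y, inner A ((T : E →L[ℂ] F) x) y = inner A x (S y)) :
    (adjoint T : F →L[ℂ] E) = S := by
  ext y
  exact eq_of_inner_eq (A := A) fun z => by rw [← inner_adjoint, h]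

variable (A E)

/-- The algebra of adjointable operators on a Hilbert `A`-module, as an algebra of operators. -/
def adjointableSubalgebra : Subalgebra ℂ (E →L[ℂ] E) where
  carrier := {T | T ∈ adjointable A E E}
  mul_mem' := by
    rintro T T' ⟨S, hS⟩ ⟨S', hS'⟩
    exact ⟨S' * S, fun x y => by simp [hS, hS']⟩
  add_mem' := (adjointable A E E).add_mem
  algebraMap_mem' z := ⟨algebraMap ℂ _ (star z), fun x y => by
    simp [Algebra.algebraMap_eq_smul_one]⟩

/-- The C⋆-algebra of adjointable operators on a Hilbert `A`-module, with the operator norm.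
For `A = Bᵐᵒᵖ` this is the algebra of adjointable right Hilbert `B`-module maps on `E`. -/
def AdjointableEnd : Type _ := adjointableSubalgebra A E

namespace AdjointableEnd

variable {A E}

/-- The underlying bounded operator. -/
def toCLM (T : AdjointableEnd A E) : E →L[ℂ] E := T.1

instance : CoeOut (AdjointableEnd A E) (E →L[ℂ] E) := ⟨toCLM⟩

lemma toCLM_injective : Function.Injective (toCLM (A := A) (E := E)) := Subtype.val_injective

instance : NormedRing (AdjointableEnd A E) :=
  inferInstanceAs (NormedRing (adjointableSubalgebra A E))

instance : NormedAlgebra ℂ (AdjointableEnd A E) :=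
  inferInstanceAs (NormedAlgebra ℂ (adjointableSubalgebra A E))

instance : Star (AdjointableEnd A E) := ⟨fun T => adjoint (⟨T.1, T.2⟩ : adjointable A E E)⟩

lemma norm_def (T : AdjointableEnd A E) : ‖T‖ = ‖(T : E →L[ℂ] E)‖ := rfl

lemma inner_star (T : AdjointableEnd A E) (x y : E) :
    inner A ((T : E →L[ℂ] E) x) y = inner A x ((star T : AdjointableEnd A E).toCLM y) :=
  inner_adjoint (⟨T.1, T.2⟩ : adjointable A E E) x y

lemma star_eq {T S : AdjointableEnd A E}
    (h : ∀ x y, inner A (T.toCLM x) y = inner A x (S.toCLM y)) : star T = S :=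
  toCLM_injective (adjoint_eq (T := (⟨T.1, T.2⟩ : adjointable A E E)) h)

@[simp] lemma toCLM_add (S T : AdjointableEnd A E) : (S + T).toCLM = S.toCLM + T.toCLM := rfl

@[simp] lemma toCLM_sub (S T : AdjointableEnd A E) : (S - T).toCLM = S.toCLM - T.toCLM := rfl

@[simp] lemma toCLM_mul (S T : AdjointableEnd A E) : (S * T).toCLM = S.toCLM * T.toCLM := rfl

@[simp] lemma toCLM_smul (z : ℂ) (T : AdjointableEnd A E) : (z • T).toCLM = z • T.toCLM := rfl

instance : StarRing (AdjointableEnd A E) where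
  star_involutive T := star_eq fun x y => by
    rw [← CStarModule.star_inner, ← inner_star, CStarModule.star_inner]
  star_mul S T := star_eq fun x y => by simp [inner_star]
  star_add S T := star_eq fun x y => by simp [inner_star]

instance : StarModule ℂ (AdjointableEnd A E) where
  star_smul z T := star_eq fun x y => by simp [inner_star]

instance : CStarRing (AdjointableEnd A E) where
  norm_mul_self_le T := by
    have h : ‖T‖ ≤ √‖star T * T‖ := by
      refine ContinuousLinearMap.opNorm_le_bound _ (Real.sqrt_nonneg _) fun x => ?_
      refine abs_le_of_sq_le_sq' ?_ (by positivity) |>.2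
      rw [mul_pow, Real.sq_sqrt (norm_nonneg _)]
      calc ‖T.toCLM x‖ ^ 2 = ‖inner A (T.toCLM x) (T.toCLM x)‖ := CStarModule.norm_sq_eq A
        _ = ‖inner A x ((star T * T).toCLM x)‖ := by rw [inner_star]; rfl
        _ ≤ ‖x‖ * ‖(star T * T).toCLM x‖ := CStarModule.norm_inner_le E
        _ ≤ ‖x‖ * (‖star T * T‖ * ‖x‖) := by
          gcongr; exact ContinuousLinearMap.le_opNorm _ _
        _ = _ := by ring
    calc ‖T‖ * ‖T‖ ≤ √‖star T * T‖ * √‖star T * T‖ := by gcongr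
      _ = _ := Real.mul_self_sqrt (norm_nonneg _)

variable [CompleteSpace E]

instance : CompleteSpace (AdjointableEnd A E) := by
  refine Metric.complete_of_cauchySeq_tendsto fun u hu => ?_
  have h1 : CauchySeq fun n => (u n).toCLM :=
    Metric.cauchySeq_iff.mpr fun ε hε => by
      obtain ⟨N, hN⟩ := Metric.cauchySeq_iff.mp hu ε hε
      exact ⟨N, fun m hm n hn => hN m hm n hn⟩
  have h2 : CauchySeq fun n => (star (u n)).toCLM :=
    Metric.cauchySeq_iff.mpr fun ε hε => by
      obtain ⟨N, hN⟩ := Metric.cauchySeq_iff.mp hu ε hε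
      refine ⟨N, fun m hm n hn => ?_⟩
      have := hN m hm n hn
      rwa [dist_eq_norm, ← norm_star, star_sub, ← dist_eq_norm] at this
  obtain ⟨T, hT⟩ := cauchySeq_tendsto_of_complete h1
  obtain ⟨S, hS⟩ := cauchySeq_tendsto_of_complete h2
  have key : ∀ x y, inner A (T x) y = inner A x (S y) := fun x y => by
    have hc := CStarModule.continuous_inner (A := A) (E := E)
    have a1 : Filter.Tendsto (fun n => inner A ((u n).toCLM x) y) Filter.atTop
        (nhds (inner A (T x) y)) :=
      (hc.tendsto (T x, y)).comp
        ((((ContinuousLinearMap.apply ℂ E x).continuous.tendsto T).comp hT).prodMk_nhds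
          tendsto_const_nhds)
    have a2 : Filter.Tendsto (fun n => inner A x ((star (u n)).toCLM y)) Filter.atTop
        (nhds (inner A x (S y))) :=
      (hc.tendsto (x, S y)).comp (tendsto_const_nhds.prodMk_nhds
        (((ContinuousLinearMap.apply ℂ E y).continuous.tendsto S).comp hS))
    simp only [inner_star] at a1
    exact tendsto_nhds_unique a1 a2
  exact ⟨⟨T, S, key⟩, tendsto_subtype_rng.mpr hT⟩

instance : CStarAlgebra (AdjointableEnd A E) where

/-- The order of the C⋆-algebra of adjointable operators: `S ≤ T` if and only if `T - S` is a
positive element. -/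
instance : PartialOrder (AdjointableEnd A E) := CStarAlgebra.spectralOrder _

instance : StarOrderedRing (AdjointableEnd A E) := CStarAlgebra.spectralOrderedRing _

end AdjointableEnd

end Adjointable

/-! ### Equivalence bimodules -/

section Bimodule

open MulOpposite

variable (C D Y : Type*)
  [CStarAlgebra C] [PartialOrder C] [StarOrderedRing C]
  [CStarAlgebra D] [PartialOrder D] [StarOrderedRing D]
  [NormedAddCommGroup Y] [NormedSpace ℂ Y] [SMul C Y] [SMul Dᵐᵒᵖ Y]
  [CStarModule C Y] [CStarModule Dᵐᵒᵖ Y]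

/-- A `C`-`D`-equivalence bimodule: a full left Hilbert `C`-module which is a full right Hilbert
`D`-module such that the actions are compatible with each other and with the inner products. -/
structure IsEquivalenceBimodule : Prop where
  complete : CompleteSpace Y
  smul_op_smul : ∀ (c : C) (d : D) (y : Y), c • (op d • y) = op d • (c • y)
  rightInner_smul : ∀ (c : C) (x y : Y), rightInner D (c • x) y = rightInner D x (star c • y)
  leftInner_op_smul : ∀ (d : D) (x y : Y),
    leftInner C (op d • x) y = leftInner C x (op (star d) • y)
  leftInner_smul_eq : ∀ x y z : Y, leftInner C x y • z = op (rightInner D y z) • x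
  left_full : (Submodule.span ℂ {c : C | ∃ x y : Y, c = leftInner C x y}).topologicalClosure = ⊤
  right_full : (Submodule.span ℂ {d : D | ∃ x y : Y, d = rightInner D x y}).topologicalClosure = ⊤

variable {D Y}

/-- A finite left `C`-basis: `y = ∑ i, _C⟨y, u i⟩ · u i` for every `y`. -/
def IsLeftBasis {n : ℕ} (u : Fin n → Y) : Prop :=
  ∀ y : Y, y = ∑ i, leftInner C y (u i) • u i

end Bimodule

/-! ### Representations on right Hilbert modules -/

section Rep

open MulOpposite

variable {B : Type*} [CStarAlgebra B] [PartialOrder B] [StarOrderedRing B]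
variable {C : Type*} [CStarAlgebra C] [PartialOrder C] [StarOrderedRing C]
variable {D : Type*} [CStarAlgebra D] [PartialOrder D] [StarOrderedRing D]
variable {E : Type*} [NormedAddCommGroup E] [NormedSpace ℂ E] [CompleteSpace E]
  [SMul Bᵐᵒᵖ E] [CStarModule Bᵐᵒᵖ E]
variable {F : Type*} [NormedAddCommGroup F] [NormedSpace ℂ F] [CompleteSpace F]
  [SMul Bᵐᵒᵖ F] [CStarModule Bᵐᵒᵖ F]
variable {Y : Type*} [NormedAddCommGroup Y] [NormedSpace ℂ Y] [SMul C Y] [SMul Dᵐᵒᵖ Y]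
  [CStarModule C Y] [CStarModule Dᵐᵒᵖ Y]

/-- A representation of `C` on `E` is non-degenerate if `π(C)E` spans a dense subspace. -/
def IsNondegenerate (π : C →⋆ₙₐ[ℂ] AdjointableEnd Bᵐᵒᵖ E) : Prop :=
  (Submodule.span ℂ {e : E | ∃ (c : C) (x : E), e = (π c).toCLM x}).topologicalClosure = ⊤

/-- Unitary equivalence of representations of `C` on right Hilbert `B`-modules. -/
def UnitarilyEquivalent (π₁ : C →⋆ₙₐ[ℂ] AdjointableEnd Bᵐᵒᵖ E)
    (π₂ : C →⋆ₙₐ[ℂ] AdjointableEnd Bᵐᵒᵖ F) : Prop :=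
  ∃ U : adjointable Bᵐᵒᵖ E F,
    (adjoint U : F →L[ℂ] E) ∘L (U : E →L[ℂ] F) = ContinuousLinearMap.id ℂ E ∧
    (U : E →L[ℂ] F) ∘L (adjoint U : F →L[ℂ] E) = ContinuousLinearMap.id ℂ F ∧
    ∀ c, (π₂ c).toCLM = (U : E →L[ℂ] F) ∘L (π₁ c).toCLM ∘L (adjoint U : F →L[ℂ] E)

/-- `πY : Y → B_B(F, E)` implements a strong Morita equivalence of the representation `πC` of `C`
on `E` with the representation `πD` of `D` on `F`. -/
structure IsMoritaIntertwiner (πC : C →⋆ₙₐ[ℂ] AdjointableEnd Bᵐᵒᵖ E)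
    (πD : D →⋆ₙₐ[ℂ] AdjointableEnd Bᵐᵒᵖ F) (πY : Y →ₗ[ℂ] adjointable Bᵐᵒᵖ F E) : Prop where
  mul_adjoint : ∀ y z : Y,
    (πY y : F →L[ℂ] E) ∘L (adjoint (πY z) : E →L[ℂ] F) = (πC (leftInner C y z)).toCLM
  adjoint_mul : ∀ y z : Y,
    (adjoint (πY y) : E →L[ℂ] F) ∘L (πY z : F →L[ℂ] E) = (πD (rightInner D y z)).toCLM
  map_smul_smul : ∀ (c : C) (y : Y) (d : D),
    (πY (c • (op d • y)) : F →L[ℂ] E) = (πC c).toCLM ∘L (πY y : F →L[ℂ] E) ∘L (πD d).toCLM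

/-- Strong Morita equivalence of non-degenerate representations of `C` and `D` on right Hilbert
`B`-modules (with the equivalence bimodule in universe `w`). -/
def RepStronglyMoritaEquivalent.{w, uB, uC, uD, uE, uF} {B : Type uB} [CStarAlgebra B]
    [PartialOrder B] [StarOrderedRing B] {C : Type uC} [CStarAlgebra C] [PartialOrder C]
    [StarOrderedRing C] {D : Type uD} [CStarAlgebra D] [PartialOrder D] [StarOrderedRing D]
    {E : Type uE} [NormedAddCommGroup E] [NormedSpace ℂ E] [CompleteSpace E]
    [SMul Bᵐᵒᵖ E] [CStarModule Bᵐᵒᵖ E]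
    {F : Type uF} [NormedAddCommGroup F] [NormedSpace ℂ F] [CompleteSpace F]
    [SMul Bᵐᵒᵖ F] [CStarModule Bᵐᵒᵖ F]
    (πC : C →⋆ₙₐ[ℂ] AdjointableEnd Bᵐᵒᵖ E) (πD : D →⋆ₙₐ[ℂ] AdjointableEnd Bᵐᵒᵖ F) : Prop :=
  IsNondegenerate πC ∧ IsNondegenerate πD ∧
  ∃ (Y : Type w) (_ : NormedAddCommGroup Y) (_ : NormedSpace ℂ Y) (_ : SMul C Y)
    (_ : SMul Dᵐᵒᵖ Y) (_ : CStarModule C Y) (_ : CStarModule Dᵐᵒᵖ Y)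
    (πY : Y →ₗ[ℂ] adjointable Bᵐᵒᵖ F E),
    IsEquivalenceBimodule C D Y ∧ IsMoritaIntertwiner πC πD πY

/-- `E`, together with the bilinear map `τ : (y, f) ↦ y ⊗ f`, is the interior tensor product
`Y ⊗_D F` over the representation `πD` of `D` on `F`: the completion of the algebraic tensor
product with respect to `⟨y ⊗ f, z ⊗ g⟩_B = ⟨f, πD(⟨y, z⟩_D) g⟩_B`. -/
structure IsInteriorTensorProduct (πD : D →⋆ₙₐ[ℂ] AdjointableEnd Bᵐᵒᵖ F)
    (τ : Y →ₗ[ℂ] F →ₗ[ℂ] E) : Prop where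
  rightInner_tmul : ∀ (y z : Y) (f g : F),
    rightInner B (τ y f) (τ z g) = rightInner B f ((πD (rightInner D y z)).toCLM g)
  dense_span : (Submodule.span ℂ {e : E | ∃ (y : Y) (f : F), e = τ y f}).topologicalClosure = ⊤

variable (Y) in
/-- The representation `πC` of `C` on `E` is the one induced by the bimodule `Y` from the
representation `πD` of `D` on `F`: `E = Y ⊗_D F` and `πC(c)(y ⊗ f) = (c · y) ⊗ f`. -/
def IsInducedRep (πD : D →⋆ₙₐ[ℂ] AdjointableEnd Bᵐᵒᵖ F)
    (πC : C →⋆ₙₐ[ℂ] AdjointableEnd Bᵐᵒᵖ E) : Prop :=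
  ∃ τ : Y →ₗ[ℂ] F →ₗ[ℂ] E, IsInteriorTensorProduct πD τ ∧
    ∀ (c : C) (y : Y) (f : F), (πC c).toCLM (τ y f) = τ (c • y) f

/-- `(π, V, E)` is a minimal KSGNS-representation for `ψ : D → B_B(F)`. -/
structure IsMinimalKSGNS (ψ : D →CP AdjointableEnd Bᵐᵒᵖ F)
    (π : D →⋆ₙₐ[ℂ] AdjointableEnd Bᵐᵒᵖ E) (V : adjointable Bᵐᵒᵖ F E) : Prop where
  eq_conj : ∀ d : D,
    (ψ d).toCLM = (adjoint V : E →L[ℂ] F) ∘L (π d).toCLM ∘L (V : F →L[ℂ] E)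
  dense_span : (Submodule.span ℂ {e : E | ∃ (d : D) (f : F),
    e = (π d).toCLM ((V : F →L[ℂ] E) f)}).topologicalClosure = ⊤

/-- Completely positive maps `φ : C → B_B(E)` and `ψ : D → B_B(F)` are strongly Morita equivalent
if a minimal KSGNS-representation for `φ` is strongly Morita equivalent to one for `ψ`. The
modules of the KSGNS-constructions live in the universes of `C × E` and `D × F`. -/
def StronglyMoritaEquivalent.{w, uB, uC, uD, uE, uF} {B : Type uB} [CStarAlgebra B]
    [PartialOrder B] [StarOrderedRing B] {C : Type uC} [CStarAlgebra C] [PartialOrder C]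
    [StarOrderedRing C] {D : Type uD} [CStarAlgebra D] [PartialOrder D] [StarOrderedRing D]
    {E : Type uE} [NormedAddCommGroup E] [NormedSpace ℂ E] [CompleteSpace E]
    [SMul Bᵐᵒᵖ E] [CStarModule Bᵐᵒᵖ E]
    {F : Type uF} [NormedAddCommGroup F] [NormedSpace ℂ F] [CompleteSpace F]
    [SMul Bᵐᵒᵖ F] [CStarModule Bᵐᵒᵖ F]
    (φ : C →CP AdjointableEnd Bᵐᵒᵖ E) (ψ : D →CP AdjointableEnd Bᵐᵒᵖ F) : Prop :=
  ∃ (H : Type (max uC uE)) (_ : NormedAddCommGroup H) (_ : NormedSpace ℂ H) (_ : CompleteSpace H)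
    (_ : SMul Bᵐᵒᵖ H) (_ : CStarModule Bᵐᵒᵖ H)
    (πφ : C →⋆ₙₐ[ℂ] AdjointableEnd Bᵐᵒᵖ H) (Vφ : adjointable Bᵐᵒᵖ E H)
    (G : Type (max uD uF)) (_ : NormedAddCommGroup G) (_ : NormedSpace ℂ G) (_ : CompleteSpace G)
    (_ : SMul Bᵐᵒᵖ G) (_ : CStarModule Bᵐᵒᵖ G)
    (πψ : D →⋆ₙₐ[ℂ] AdjointableEnd Bᵐᵒᵖ G) (Vψ : adjointable Bᵐᵒᵖ F G),
    IsMinimalKSGNS φ πφ Vφ ∧ IsMinimalKSGNS ψ πψ Vψ ∧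
      RepStronglyMoritaEquivalent.{w} πφ πψ

end Rep

end HilbertModule

end

universe uB uC uD uY uF uG uH uE

noncomputable section

namespace HilbertModule

open MulOpposite

/-! ### Positivity of matrices over a C⋆-algebra and of matrices of adjointable operators -/

section Positivity

/-! The map `φ` is a compression of an induced representation. Take a minimal KSGNS-representation
(π, V, G) of ψ, the module E = Y ⊗_D G, the representation π_C(c)(y ⊗ g) = cy ⊗ g, and the creation
operators T_y g = y ⊗ g, for which T_y⋆(z ⊗ g) = π(⟨y, z⟩_D) g. For the row operator W x = ∑ u_j ⊗ V
x_j, the (i, j) entry of W⋆ π_C(c) W is V⋆ T_{u_i}⋆ T_{c u_j} V = ψ(⟨u_i, c u_j⟩_D). So φ = W⋆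
π_C(·) W, and complete positivity is automatic (`conjCP`,
`IsMinimalKSGNS.conj_rowMap_creation_apply`).

The basis property makes (π_C, W, E) minimal: y ⊗ Vf = ∑ π_C(_C⟨y, u_i⟩) W(f in slot i), and y ⊗
π(d)Vf = yd ⊗ Vf takes care of the rest of G (`IsMinimalKSGNS.induced`). Uniqueness of minimal
KSGNS-representations (`IsMinimalKSGNS.unitarilyEquivalent`) then gives the third claim. The map y ↦
T_y, moved along the resulting unitary, is the required intertwiner, with Z = Y.

Both the KSGNS module and the interior tensor product are Kolmogorov decompositions of positive
kernels (`exists_kolmogorov_linear`), with kernels ψ(x⋆y) and π(⟨x, y⟩_D). In both cases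
`exists_rep_of_action` supplies the representation. -/

lemma exists_eq_star_mul_self {R : Type*} [NonUnitalCStarAlgebra R] [PartialOrder R]
    [StarOrderedRing R] {a : R} (ha : 0 ≤ a) : ∃ s : R, a = star s * s :=
  CStarAlgebra.nonneg_iff_eq_star_mul_self.mp ha

/-- A self-adjoint element `a` is nonnegative if, for self-adjoint `b`, the element `-(b a b)` is
of the form `star s * s` only for `s = 0`. -/
lemma nonneg_of_conj {R : Type*} [NonUnitalCStarAlgebra R] [PartialOrder R]
    [StarOrderedRing R] {a : R} (ha : IsSelfAdjoint a)
    (h : ∀ b s : R, star b = b → star s * s = -(b * a * b) → s = 0) : 0 ≤ a := by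
  have hn : 0 ≤ a⁻ := CFC.negPart_nonneg a
  have hsa : star a⁻ = a⁻ := hn.isSelfAdjoint
  -- Test the hypothesis with b = a⁻: as a⁻a = -(a⁻)², the element -(bab) is (a⁻)³ ≥ 0. Hence (a⁻)³
  -- = 0, and a self-adjoint nilpotent vanishes.
  have h3 : -(a⁻ * a * a⁻) = a⁻ * a⁻ * a⁻ := by
    have : a⁻ * a = -(a⁻ * a⁻) := by
      calc a⁻ * a = a⁻ * (a⁺ - a⁻) := by rw [CFC.posPart_sub_negPart a ha]
        _ = _ := by rw [mul_sub, CFC.negPart_mul_posPart, zero_sub]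
    rw [this, neg_mul, neg_neg]
  have h3' : 0 ≤ a⁻ * a⁻ * a⁻ := by
    have := star_left_conjugate_nonneg hn a⁻
    rwa [hsa] at this
  obtain ⟨s, hs⟩ := exists_eq_star_mul_self h3'
  have h0 : a⁻ * a⁻ * a⁻ = 0 := by
    rw [hs, h a⁻ s hsa (by rw [h3, hs]), mul_zero]
  have h2 : a⁻ * a⁻ = 0 := by
    rw [← CStarRing.star_mul_self_eq_zero_iff, star_mul, hsa, ← mul_assoc, h0, zero_mul]
  have h1 : a⁻ = 0 := by
    rw [← CStarRing.star_mul_self_eq_zero_iff, hsa, h2]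
  exact (CFC.negPart_eq_zero_iff a ha).mp h1

variable {A : Type*} [CStarAlgebra A] [PartialOrder A] [StarOrderedRing A]

/-- A self-adjoint matrix over a C⋆-algebra is nonnegative if its quadratic form is. -/
lemma cstarMatrix_nonneg {ι : Type*} [Fintype ι] {M : CStarMatrix ι ι A}
    (hM : IsSelfAdjoint M) (h : ∀ a : ι → A, 0 ≤ ∑ i, ∑ j, star (a i) * M i j * a j) : 0 ≤ M := by
  refine nonneg_of_conj hM fun b s hb hs => CStarMatrix.ext fun k l => ?_
  -- The form at the `l`-th column of `b` is the diagonal entry (bMb)_{ll} ≥ 0. It equals minus a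
  -- sum of squares of the entries in column `l` of `s`, so all of these vanish.
  have h1 := h fun i => b i l
  have h2 : ∑ i, ∑ j, star (b i l) * M i j * b j l = (b * M * b) l l := by
    simp only [CStarMatrix.mul_apply, Finset.sum_mul]
    rw [Finset.sum_comm]
    refine Finset.sum_congr rfl fun j _ => Finset.sum_congr rfl fun i _ => ?_
    rw [← CStarMatrix.star_apply, hb]
  have h3 : ∑ k, star (s k l) * s k l = -(b * M * b) l l := by
    rw [← CStarMatrix.neg_apply, ← hs, CStarMatrix.mul_apply]
    rfl
  rw [h2, ← neg_nonpos, ← h3] at h1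
  have h4 : ∀ k ∈ Finset.univ, 0 ≤ star (s k l) * s k l := fun k _ => star_mul_self_nonneg _
  exact CStarRing.star_mul_self_eq_zero_iff _ |>.mp <|
    (Finset.sum_eq_zero_iff_of_nonneg h4).mp (le_antisymm h1 (Finset.sum_nonneg h4)) k
      (Finset.mem_univ k)

variable {E : Type*} [NormedAddCommGroup E] [NormedSpace ℂ E] [SMul A E] [CStarModule A E]

namespace AdjointableEnd

@[simp] lemma toCLM_neg (T : AdjointableEnd A E) : (-T).toCLM = -T.toCLM := rfl

@[simp] lemma toCLM_sum {ι : Type*} (s : Finset ι) (T : ι → AdjointableEnd A E) :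
    (∑ i ∈ s, T i).toCLM = ∑ i ∈ s, (T i).toCLM :=
  map_sum (⟨⟨toCLM, rfl⟩, fun _ _ => rfl⟩ : AdjointableEnd A E →+ (E →L[ℂ] E)) T s

lemma inner_toCLM_star (T : AdjointableEnd A E) (x y : E) :
    inner A x ((star T).toCLM y) = inner A (T.toCLM x) y :=
  (inner_star T x y).symm

variable [CompleteSpace E] {ι : Type*} [Fintype ι]

lemma toCLM_matrix_mul (S T : CStarMatrix ι ι (AdjointableEnd A E)) (i j : ι) (x : E) :
    ((S * T) i j).toCLM x = ∑ k, (S i k).toCLM ((T k j).toCLM x) := by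
  rw [CStarMatrix.mul_apply, toCLM_sum, sum_apply]
  rfl

lemma inner_star_mul_self_matrix (S : CStarMatrix ι ι (AdjointableEnd A E)) (i j : ι) (x y : E) :
    inner A x (((star S * S) i j).toCLM y) =
      ∑ k, inner A ((S k i).toCLM x) ((S k j).toCLM y) := by
  simp only [toCLM_matrix_mul, CStarMatrix.star_apply, CStarModule.inner_sum_right,
    inner_toCLM_star]

/-- Writing M = S⋆S turns the quadratic form into ∑_k ⟨(Sx)_k, (Sx)_k⟩. -/
lemma inner_matrix_nonneg {M : CStarMatrix ι ι (AdjointableEnd A E)} (hM : 0 ≤ M) (x : ι → E) :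
    0 ≤ ∑ i, ∑ j, inner A (x i) ((M i j).toCLM (x j)) := by
  obtain ⟨S, rfl⟩ := exists_eq_star_mul_self hM
  have : ∑ i, ∑ j, inner A (x i) (((star S * S) i j).toCLM (x j)) =
      ∑ k, inner A (∑ i, (S k i).toCLM (x i)) (∑ i, (S k i).toCLM (x i)) := by
    simp only [inner_star_mul_self_matrix, CStarModule.inner_sum_right,
      CStarModule.inner_sum_left]
    rw [Finset.sum_comm]
    conv_lhs => enter [2, j]; rw [Finset.sum_comm]
    rw [Finset.sum_comm]
  rw [this]
  exact Finset.sum_nonneg fun k _ => CStarModule.inner_self_nonneg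

/-- A self-adjoint matrix of adjointable operators is nonnegative if its quadratic form is. -/
lemma matrix_nonneg {M : CStarMatrix ι ι (AdjointableEnd A E)} (hM : IsSelfAdjoint M)
    (h : ∀ x : ι → E, 0 ≤ ∑ i, ∑ j, inner A (x i) ((M i j).toCLM (x j))) : 0 ≤ M := by
  refine nonneg_of_conj hM fun b s hb hs => CStarMatrix.ext fun k l => toCLM_injective ?_
  ext x
  -- The column argument of `cstarMatrix_nonneg`, with the column of `b` applied to a vector.
  have h1 := h fun i => (b i l).toCLM x
  have h2 : ∑ i, ∑ j, inner A ((b i l).toCLM x) ((M i j).toCLM ((b j l).toCLM x)) =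
      inner A x (((b * M * b) l l).toCLM x) := by
    rw [mul_assoc]
    simp only [toCLM_matrix_mul, CStarModule.inner_sum_right, map_sum]
    refine Finset.sum_congr rfl fun i _ => Finset.sum_congr rfl fun j _ => ?_
    rw [← inner_toCLM_star, ← CStarMatrix.star_apply, hb]
  have h3 : ∑ k, inner A ((s k l).toCLM x) ((s k l).toCLM x) =
      -inner A x (((b * M * b) l l).toCLM x) := by
    rw [← inner_star_mul_self_matrix, hs, CStarMatrix.neg_apply, toCLM_neg]
    simp
  rw [h2, ← neg_nonpos, ← h3] at h1
  have h4 : ∀ k ∈ Finset.univ, 0 ≤ inner A ((s k l).toCLM x) ((s k l).toCLM x) :=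
    fun k _ => CStarModule.inner_self_nonneg
  exact (CStarModule.inner_self (A := A)).mp <|
    (Finset.sum_eq_zero_iff_of_nonneg h4).mp (le_antisymm h1 (Finset.sum_nonneg h4)) k
      (Finset.mem_univ k)

end AdjointableEnd

end Positivity

/-! ### Separation and completion of a semidefinite inner product -/

section SemiInner

variable {A : Type*} [CStarAlgebra A] [PartialOrder A] [StarOrderedRing A]

/-- A positive semidefinite `A`-valued inner product. -/
structure IsSemiInner {V : Type*} [AddCommGroup V] [Module ℂ V] [SMul A V]
    (form : V →ₗ⋆[ℂ] V →ₗ[ℂ] A) : Prop where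
  star_form : ∀ x y, star (form x y) = form y x
  nonneg : ∀ x, 0 ≤ form x x
  smul_right : ∀ (a : A) (x y : V), form x (a • y) = a * form x y

namespace IsSemiInner

variable {V : Type*} [AddCommGroup V] [Module ℂ V] [SMul A V] {form : V →ₗ⋆[ℂ] V →ₗ[ℂ] A}

lemma smul_left (h : IsSemiInner form) (a : A) (x y : V) :
    form (a • x) y = form x y * star a := by
  rw [← h.star_form, h.smul_right, star_mul, h.star_form]

/-- Operator Cauchy–Schwarz: expand the form at ⟨x, y⟩x - ry. A positive bound `r` replaces ‖⟨x,
x⟩‖, which may be zero, so that one factor `r` can be cancelled. -/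
lemma form_mul_form_le (h : IsSemiInner form) {x : V} {r : ℝ} (hr : 0 < r)
    (hx : ‖form x x‖ ≤ r) (y : V) : form x y * form y x ≤ r • form y y := by
  have h1 : 0 ≤ form (form x y • x - (r : ℂ) • y) (form x y • x - (r : ℂ) • y) := h.nonneg _
  have h2 : form (form x y • x - (r : ℂ) • y) (form x y • x - (r : ℂ) • y) =
      form x y * form x x * star (form x y) - r • (form x y * form y x)
        - (r • (form x y * form y x) - r • r • form y y) := by
    simp only [map_sub, LinearMap.sub_apply, map_smulₛₗ, LinearMap.smul_apply, h.smul_right,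
      h.smul_left, h.star_form, smul_sub]
    simp [mul_assoc]
  have h3 : form x y * form x x * star (form x y) ≤ r • (form x y * form y x) := by
    refine CStarAlgebra.star_right_conjugate_le_norm_smul (h.nonneg x).isSelfAdjoint |>.trans ?_
    rw [h.star_form]
    refine smul_le_smul_of_nonneg_right hx ?_
    rw [← h.star_form x y]
    exact mul_star_self_nonneg _
  rw [h2] at h1
  have h4 : r • (form x y * form y x) ≤ r • r • form y y := by
    have := h1.trans (sub_le_sub_right (sub_le_sub_right h3 _) _)
    simpa using this
  exact (smul_le_smul_iff_of_pos_left hr).mp h4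

lemma norm_form_sq_le (h : IsSemiInner form) (x y : V) :
    ‖form x y‖ ^ 2 ≤ ‖form x x‖ * ‖form y y‖ := by
  have key : ∀ r : ℝ, ‖form x x‖ < r → ‖form x y‖ ^ 2 ≤ r * ‖form y y‖ := by
    intro r hr
    have hr0 : 0 < r := (norm_nonneg _).trans_lt hr
    calc ‖form x y‖ ^ 2 = ‖form x y * form y x‖ := by
          rw [← h.star_form x, CStarRing.norm_self_mul_star, pow_two]
      _ ≤ ‖r • form y y‖ := by
          refine CStarAlgebra.norm_le_norm_of_nonneg_of_le ?_ (h.form_mul_form_le hr0 hr.le y)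
          rw [← h.star_form x]
          exact mul_star_self_nonneg _
      _ = r * ‖form y y‖ := by rw [norm_smul, Real.norm_of_nonneg hr0.le]
  -- Let `r` decrease to ‖⟨x, x⟩‖, which also covers the degenerate case.
  have hc : Filter.Tendsto (fun r : ℝ => r * ‖form y y‖)
      (nhdsWithin ‖form x x‖ (Set.Ioi ‖form x x‖))
      (nhds (‖form x x‖ * ‖form y y‖)) :=
    ((continuous_id.mul continuous_const).tendsto _).mono_left nhdsWithin_le_nhds
  exact ge_of_tendsto hc (eventually_nhdsWithin_of_forall key)

lemma norm_form_le (h : IsSemiInner form) (x y : V) :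
    ‖form x y‖ ≤ √‖form x x‖ * √‖form y y‖ := by
  rw [← Real.sqrt_mul (norm_nonneg _)]
  exact Real.le_sqrt_of_sq_le (h.norm_form_sq_le x y)

/-- The Hilbert module obtained from a positive semidefinite inner product by separation and
completion. -/
theorem exists_completion.{v} {V : Type v} [AddCommGroup V] [Module ℂ V] [SMul A V]
    {form : V →ₗ⋆[ℂ] V →ₗ[ℂ] A} (h : IsSemiInner form) :
    ∃ (E : Type v) (_ : NormedAddCommGroup E) (_ : NormedSpace ℂ E) (_ : CompleteSpace E)
      (_ : SMul A E) (_ : CStarModule A E) (j : V →ₗ[ℂ] E),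
      (∀ x y, inner A (j x) (j y) = form x y) ∧ DenseRange j := by
  let : Norm V := ⟨fun x => √‖form x x‖⟩
  have norm_def : ∀ x : V, ‖x‖ = √‖form x x‖ := fun _ => rfl
  have norm_sq : ∀ x : V, ‖x‖ ^ 2 = ‖form x x‖ := fun x => Real.sq_sqrt (norm_nonneg _)
  have core : SeminormedSpace.Core ℂ V :=
    { norm_nonneg := fun x => Real.sqrt_nonneg _
      norm_smul := fun c x => by
        have : ‖form (c • x) (c • x)‖ = ‖c‖ ^ 2 * ‖form x x‖ := by
          simp [norm_smul, pow_two, mul_assoc]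
        rw [norm_def, this, Real.sqrt_mul (sq_nonneg _), Real.sqrt_sq (norm_nonneg _), norm_def]
      norm_triangle := fun x y => by
        rw [norm_def (x + y)]
        refine Real.sqrt_le_iff.mpr ⟨add_nonneg (Real.sqrt_nonneg _) (Real.sqrt_nonneg _), ?_⟩
        have h1 : ‖form x y‖ ≤ ‖x‖ * ‖y‖ := h.norm_form_le x y
        have h2 : ‖form y x‖ ≤ ‖y‖ * ‖x‖ := h.norm_form_le y x
        calc ‖form (x + y) (x + y)‖
            = ‖(form x x + form y x) + (form x y + form y y)‖ := by
              simp only [map_add, LinearMap.add_apply]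
          _ ≤ (‖form x x‖ + ‖form y x‖) + (‖form x y‖ + ‖form y y‖) :=
            (norm_add_le _ _).trans (add_le_add (norm_add_le _ _) (norm_add_le _ _))
          _ ≤ (‖x‖ ^ 2 + ‖y‖ * ‖x‖) + (‖x‖ * ‖y‖ + ‖y‖ ^ 2) := by
            rw [norm_sq, norm_sq]; gcongr
          _ = (‖x‖ + ‖y‖) ^ 2 := by ring }
  let : SeminormedAddCommGroup V := SeminormedAddCommGroup.ofCore core
  let : NormedSpace ℂ V := ⟨fun c x => (core.norm_smul c x).le⟩
  let : Inner A V := ⟨fun x y => form x y⟩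
  let formL : V →L⋆[ℂ] V →L[ℂ] A :=
    LinearMap.mkContinuous₂ form 1 fun x y => by
      rw [one_mul]
      exact h.norm_form_le x y
  have hcont : Continuous fun p : V × V => inner A p.1 p.2 := by
    change Continuous fun p : V × V => formL p.1 p.2
    fun_prop
  -- The action on `V` is a bare `SMul`, so additivity is not available. The form sees a • x - a • y
  -- as if it were a • (x - y), and this Lipschitz bound lets the action extend to the completion.
  have norm_sub_smul : ∀ (a : A) (x y : V), ‖a • x - a • y‖ ≤ ‖a‖ * ‖x - y‖ := by
    intro a x y
    have : form (a • x - a • y) (a • x - a • y) = a * form (x - y) (x - y) * star a := by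
      simp [h.smul_left, h.smul_right, mul_sub, sub_mul, mul_assoc]
    rw [norm_def, this]
    refine Real.sqrt_le_iff.mpr ⟨by positivity, ?_⟩
    rw [mul_pow, norm_sq]
    calc _ ≤ ‖a‖ * ‖form (x - y) (x - y)‖ * ‖star a‖ :=
          (norm_mul_le _ _).trans (by gcongr; exact norm_mul_le _ _)
      _ = _ := by rw [norm_star]; ring
  have : UniformContinuousConstSMul A V := ⟨fun a => by
    refine (LipschitzWith.of_dist_le_mul (K := ‖a‖₊) fun x y => ?_).uniformContinuous
    rw [dist_eq_norm, dist_eq_norm]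
    exact norm_sub_smul a x y⟩
  have inner_coe : ∀ x y : V,
      inner A (x : UniformSpace.Completion V) (y : UniformSpace.Completion V) = form x y :=
    fun x y => (UniformSpace.Completion.isDenseInducing_coe.prodMap
      UniformSpace.Completion.isDenseInducing_coe).extend_eq hcont (x, y)
  have cont_inner : Continuous fun p : UniformSpace.Completion V × UniformSpace.Completion V =>
      inner A p.1 p.2 := by
    let form' : V →+ V →+ A :=
      { toFun := fun x => (form x).toAddMonoidHom
        map_zero' := by ext; simp
        map_add' := fun x y => by ext; simp }
    exact UniformSpace.Completion.isDenseInducing_toCompl V |>.extend_Z_bilin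
      (UniformSpace.Completion.isDenseInducing_toCompl V) (φ := form') hcont
  have ci : ∀ {α : Type v} [TopologicalSpace α] {f g : α → UniformSpace.Completion V},
      Continuous f → Continuous g → Continuous fun a => inner A (f a) (g a) :=
    fun hf hg => cont_inner.comp (hf.prodMk hg)
  have norm_eq : ∀ x : UniformSpace.Completion V, ‖x‖ = √‖inner A x x‖ := fun x => by
    refine UniformSpace.Completion.induction_on x
      (isClosed_eq continuous_norm (ci continuous_id continuous_id).norm.sqrt) fun a => ?_
    rw [UniformSpace.Completion.norm_coe, inner_coe]
    rfl
  let cstar : CStarModule A (UniformSpace.Completion V) :=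
    { inner_add_right := fun {x y z} => by
        refine UniformSpace.Completion.induction_on₃ x y z
          (isClosed_eq (ci (by fun_prop) (by fun_prop))
            ((ci (by fun_prop) (by fun_prop)).add (ci (by fun_prop) (by fun_prop)))) ?_
        intro a b c
        rw [← UniformSpace.Completion.coe_add]
        simp only [inner_coe, map_add]
      inner_self_nonneg := fun {x} => by
        refine UniformSpace.Completion.induction_on x
          (isClosed_le continuous_const (ci continuous_id continuous_id)) fun a => ?_
        rw [inner_coe]
        exact h.nonneg a
      inner_self := fun {x} => by
        rw [← norm_eq_zero (a := x), norm_eq, Real.sqrt_eq_zero (norm_nonneg _), norm_eq_zero]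
      inner_op_smul_right := fun {a x y} => by
        refine UniformSpace.Completion.induction_on₂ x y
          (isClosed_eq (ci continuous_fst (continuous_snd.const_smul a))
            (continuous_const.mul (ci continuous_fst continuous_snd))) fun b c => ?_
        rw [← UniformSpace.Completion.coe_smul, inner_coe, inner_coe, h.smul_right]
      inner_smul_right_complex := fun {z x y} => by
        refine UniformSpace.Completion.induction_on₂ x y
          (isClosed_eq (ci continuous_fst (continuous_snd.const_smul z))
            ((ci continuous_fst continuous_snd).const_smul z)) fun b c => ?_
        rw [← UniformSpace.Completion.coe_smul, inner_coe, inner_coe, map_smul]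
      star_inner := fun x y => by
        refine UniformSpace.Completion.induction_on₂ x y
          (isClosed_eq (ci continuous_fst continuous_snd).star
            (ci continuous_snd continuous_fst)) fun b c => ?_
        rw [inner_coe, inner_coe, h.star_form]
      norm_eq_sqrt_norm_inner_self := norm_eq }
  exact ⟨UniformSpace.Completion V, inferInstance, inferInstance, inferInstance, inferInstance,
    cstar, (UniformSpace.Completion.toComplL (𝕜 := ℂ) (E := V)).toLinearMap, inner_coe,
    UniformSpace.Completion.denseRange_coe⟩

end IsSemiInner
end SemiInner

/-! ### Kolmogorov decomposition of positive kernels -/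

section Kernel

variable {A : Type*} [CStarAlgebra A] [PartialOrder A] [StarOrderedRing A]

/-- The Kolmogorov decomposition of a completely positive definite kernel with values in the
adjointable operators on a Hilbert module. -/
theorem exists_kolmogorov.{v, w} {X : Type v} {F : Type w} [NormedAddCommGroup F]
    [NormedSpace ℂ F] [SMul A F] [CStarModule A F] (k : X → X → F →L[ℂ] F)
    (hstar : ∀ x y f g, inner A (k x y f) g = inner A f (k y x g))
    (hpos : ∀ (s : Finset X) (f : X → F), 0 ≤ ∑ x ∈ s, ∑ y ∈ s, inner A (f x) (k x y (f y))) :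
    ∃ (E : Type (max v w)) (_ : NormedAddCommGroup E) (_ : NormedSpace ℂ E) (_ : CompleteSpace E)
      (_ : SMul A E) (_ : CStarModule A E) (τ : X → F →ₗ[ℂ] E),
      (∀ x y f g, inner A (τ x f) (τ y g) = inner A f (k x y g)) ∧
      (Submodule.span ℂ {e : E | ∃ x f, e = τ x f}).topologicalClosure = ⊤ := by
  classical
  have hstar' : ∀ x y f g, inner A f (k x y g) = inner A (k y x f) g :=
    fun x y f g => (hstar y x f g).symm
  have smul_zero' : ∀ a : A, a • (0 : F) = 0 := fun a =>
    eq_of_inner_eq (A := A) fun z => by simp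
  let : SMul A (X →₀ F) := ⟨fun a s => s.mapRange (a • ·) (smul_zero' a)⟩
  have smul_def : ∀ (a : A) (s : X →₀ F), a • s = s.mapRange (a • ·) (smul_zero' a) :=
    fun _ _ => rfl
  -- The module is the completion of finitely supported functions X → F, and `hpos` says exactly
  -- that this form is semidefinite.
  let form : (X →₀ F) →ₗ⋆[ℂ] (X →₀ F) →ₗ[ℂ] A := LinearMap.mk₂'ₛₗ _ _
    (fun s t => s.sum fun x f => t.sum fun y g => inner A f (k x y g))
    (fun s s' t => Finsupp.sum_add_index' (by simp) fun x f f' => by simp)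
    (fun c s t => by
      rw [Finsupp.sum_smul_index' (by simp)]
      simp [Finsupp.sum, Finset.smul_sum])
    (fun s t t' => by
      rw [← Finsupp.sum_add]
      exact Finsupp.sum_congr fun x _ => Finsupp.sum_add_index' (by simp) fun y g g' => by simp)
    (fun c s t => by
      rw [RingHom.id_apply, Finsupp.smul_sum]
      refine Finsupp.sum_congr fun x _ => ?_
      rw [Finsupp.sum_smul_index' (by simp), Finsupp.smul_sum]
      simp)
  have form_apply : ∀ s t : X →₀ F,
      form s t = s.sum fun x f => t.sum fun y g => inner A f (k x y g) := fun _ _ => rfl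
  have hform : IsSemiInner form :=
    { star_form := fun s t => by
        rw [form_apply, form_apply, Finsupp.sum_comm]
        simp only [Finsupp.sum, star_sum, CStarModule.star_inner, hstar']
      nonneg := fun s => hpos s.support s
      smul_right := fun a s t => by
        rw [form_apply, form_apply, smul_def]
        rw [Finsupp.sum, Finsupp.sum, Finset.mul_sum]
        refine Finset.sum_congr rfl fun x _ => ?_
        rw [Finsupp.sum_mapRange_index (by simp), Finsupp.sum, Finsupp.sum, Finset.mul_sum]
        simp only [hstar', CStarModule.inner_op_smul_right] }
  obtain ⟨E, i1, i2, i3, i4, i5, j, hj, hd⟩ := hform.exists_completion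
  refine ⟨E, i1, i2, i3, i4, i5, fun x => j ∘ₗ Finsupp.lsingle x, fun x y f g => ?_, ?_⟩
  · simp [hj, form_apply]
  · rw [← Submodule.dense_iff_topologicalClosure_eq_top]
    refine hd.mono ?_
    rintro _ ⟨s, rfl⟩
    induction s using Finsupp.induction_linear with
    | zero => rw [map_zero]; exact Submodule.zero_mem _
    | add s t hs ht => rw [map_add]; exact Submodule.add_mem _ hs ht
    | single x f => exact Submodule.subset_span ⟨x, f, rfl⟩

end Kernel

/-! ### Adjointability and unitaries from data on total sets -/

section Adjoint

variable {A : Type*} [CStarAlgebra A] [PartialOrder A] [StarOrderedRing A]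
variable {E : Type*} [NormedAddCommGroup E] [NormedSpace ℂ E] [SMul A E] [CStarModule A E]
variable {F : Type*} [NormedAddCommGroup F] [NormedSpace ℂ F] [SMul A F] [CStarModule A F]

lemma adjoint_inner (T : adjointable A E F) (x : F) (y : E) :
    inner A ((adjoint T : F →L[ℂ] E) x) y = inner A x ((T : E →L[ℂ] F) y) := by
  rw [← CStarModule.star_inner, ← inner_adjoint, CStarModule.star_inner]

/-- Continuous linear maps agreeing on a total set are equal. -/
lemma clm_eq_of_span {H G : Type*} [NormedAddCommGroup H] [NormedSpace ℂ H]
    [NormedAddCommGroup G] [NormedSpace ℂ G] {s : Set H}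
    (hs : (Submodule.span ℂ s).topologicalClosure = ⊤) {S T : H →L[ℂ] G}
    (h : ∀ x ∈ s, S x = T x) : S = T :=
  ContinuousLinearMap.ext_on (Submodule.dense_iff_topologicalClosure_eq_top.mpr hs) h

/-- A bounded map is adjointable if its adjoint exists on a total set. -/
theorem mem_adjointable_of_span [CompleteSpace E] (T : E →L[ℂ] F) {s : Set F}
    (hs : (Submodule.span ℂ s).topologicalClosure = ⊤)
    (h : ∀ y ∈ s, ∃ v : E, ∀ x, inner A (T x) y = inner A x v) : T ∈ adjointable A E F := by
  let P : Submodule ℂ F :=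
    { carrier := {y | ∃ v : E, ∀ x, inner A (T x) y = inner A x v}
      add_mem' := by
        rintro y y' ⟨v, hv⟩ ⟨v', hv'⟩
        exact ⟨v + v', fun x => by simp [hv, hv']⟩
      zero_mem' := ⟨0, by simp⟩
      smul_mem' := by
        rintro c y ⟨v, hv⟩
        exact ⟨c • v, fun x => by simp [hv]⟩ }
  -- The adjoint vector is controlled by ‖T‖‖y‖, so adjoint vectors of a convergent sequence are
  -- Cauchy. Hence `P` is closed and contains the closed span of `s`.
  have bound : ∀ y v, (∀ x, inner A (T x) y = inner A x v) → ‖v‖ ≤ ‖T‖ * ‖y‖ := by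
    intro y v hv
    rcases eq_or_ne v 0 with rfl | hne
    · simp only [norm_zero]; positivity
    · refine le_of_mul_le_mul_left ?_ (norm_pos_iff.mpr hne)
      calc ‖v‖ * ‖v‖ = ‖inner A (T v) y‖ := by
            rw [hv, ← pow_two, CStarModule.norm_sq_eq A]
        _ ≤ ‖T v‖ * ‖y‖ := CStarModule.norm_inner_le F
        _ ≤ ‖T‖ * ‖v‖ * ‖y‖ := by gcongr; exact T.le_opNorm v
        _ = _ := by ring
  have closed : IsClosed (P : Set F) := by
    refine IsSeqClosed.isClosed fun y y₀ hy hlim => ?_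
    choose v hv using hy
    have hc : CauchySeq v := by
      refine Metric.cauchySeq_iff.mpr fun ε hε => ?_
      obtain ⟨N, hN⟩ := Metric.cauchySeq_iff.mp hlim.cauchySeq (ε / (‖T‖ + 1)) (by positivity)
      refine ⟨N, fun m hm n hn => ?_⟩
      have h1 := bound (y m - y n) (v m - v n) fun x => by simp [hv]
      have h2 := hN m hm n hn
      rw [dist_eq_norm, lt_div_iff₀ (by positivity)] at h2
      rw [dist_eq_norm]
      nlinarith [norm_nonneg (y m - y n)]
    obtain ⟨v₀, hv₀⟩ := cauchySeq_tendsto_of_complete hc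
    refine ⟨v₀, fun x => ?_⟩
    have hF := CStarModule.continuous_inner (A := A) (E := F)
    have hE := CStarModule.continuous_inner (A := A) (E := E)
    have h1 := (hF.tendsto (T x, y₀)).comp (tendsto_const_nhds.prodMk_nhds hlim)
    have h2 := (hE.tendsto (x, v₀)).comp (tendsto_const_nhds.prodMk_nhds hv₀)
    refine tendsto_nhds_unique h1 (h2.congr fun n => ?_)
    exact (hv n x).symm
  have top : ∀ y, y ∈ P := fun y => by
    have : (Submodule.span ℂ s).topologicalClosure ≤ P :=
      Submodule.topologicalClosure_minimal _ (Submodule.span_le.mpr h) closed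
    exact this (hs ▸ Submodule.mem_top)
  choose S hS using top
  refine ⟨LinearMap.mkContinuous
    { toFun := S
      map_add' := fun y y' => eq_of_inner_eq (A := A) fun w => by simp [← hS]
      map_smul' := fun c y => eq_of_inner_eq (A := A) fun w => by simp [← hS] } ‖T‖
    fun y => bound y (S y) (hS y), fun x y => hS y x⟩

/-- Families with dense span and equal Gram matrices are related by a unitary. -/
theorem exists_unitary [CompleteSpace E] [CompleteSpace F] {ι : Type*} (a : ι → E) (b : ι → F)
    (ha : (Submodule.span ℂ (Set.range a)).topologicalClosure = ⊤)
    (hb : (Submodule.span ℂ (Set.range b)).topologicalClosure = ⊤)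
    (hab : ∀ i j, inner A (a i) (a j) = inner A (b i) (b j)) :
    ∃ U : adjointable A E F,
      (adjoint U : F →L[ℂ] E) ∘L (U : E →L[ℂ] F) = ContinuousLinearMap.id ℂ E ∧
      (U : E →L[ℂ] F) ∘L (adjoint U : F →L[ℂ] E) = ContinuousLinearMap.id ℂ F ∧
      ∀ i, (U : E →L[ℂ] F) (a i) = b i := by
  let p : (ι →₀ ℂ) →ₗ[ℂ] E := Finsupp.linearCombination ℂ a
  let q : (ι →₀ ℂ) →ₗ[ℂ] F := Finsupp.linearCombination ℂ b
  -- Equal Gram matrices give equal norms of corresponding linear combinations, so p s ↦ q s and its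
  -- inverse are well defined and extend to isometries `U` and `W`. The same identity makes `W` the
  -- adjoint of `U`.
  have inner_eq : ∀ s t, inner A (p s) (p t) = inner A (q s) (q t) := fun s t => by
    simp [p, q, Finsupp.linearCombination_apply, Finsupp.sum, hab]
  have norm_eq : ∀ s, ‖q s‖ = ‖p s‖ := fun s => by
    rw [CStarModule.norm_eq_sqrt_norm_inner_self (A := A) (q s),
      CStarModule.norm_eq_sqrt_norm_inner_self (A := A) (p s), inner_eq]
  have hp : DenseRange p := by
    rw [← Finsupp.range_linearCombination, ← Submodule.dense_iff_topologicalClosure_eq_top] at ha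
    exact ha
  have hq : DenseRange q := by
    rw [← Finsupp.range_linearCombination, ← Submodule.dense_iff_topologicalClosure_eq_top] at hb
    exact hb
  let U := LinearMap.extendOfNorm q p
  let W := LinearMap.extendOfNorm p q
  have hU : ∀ s, U (p s) = q s :=
    LinearMap.extendOfNorm_eq hp ⟨1, fun s => by rw [norm_eq, one_mul]⟩
  have hW : ∀ s, W (q s) = p s :=
    LinearMap.extendOfNorm_eq hq ⟨1, fun s => by rw [norm_eq, one_mul]⟩
  have hadj : ∀ x y, inner A (U x) y = inner A x (W y) := by
    have cE := CStarModule.continuous_inner (A := A) (E := E)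
    have cF := CStarModule.continuous_inner (A := A) (E := F)
    refine fun x y => hp.induction_on (p := fun x => inner A (U x) y = inner A x (W y)) x
      (isClosed_eq (cF.comp (by fun_prop : Continuous fun x => (U x, y)))
        (cE.comp (by fun_prop : Continuous fun x => (x, W y)))) fun s => ?_
    refine hq.induction_on (p := fun y => inner A (U (p s)) y = inner A (p s) (W y)) y
      (isClosed_eq (cF.comp (by fun_prop : Continuous fun y => (U (p s), y)))
        (cE.comp (by fun_prop : Continuous fun y => (p s, W y)))) fun t => ?_
    rw [hU, hW, inner_eq]
  have hWU : W ∘L U = ContinuousLinearMap.id ℂ E := by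
    ext x
    exact congrFun (hp.equalizer (W ∘L U).continuous continuous_id
      (funext fun s => by simp [hU, hW])) x
  have hUW : U ∘L W = ContinuousLinearMap.id ℂ F := by
    ext x
    exact congrFun (hq.equalizer (U ∘L W).continuous continuous_id
      (funext fun s => by simp [hU, hW])) x
  refine ⟨⟨U, W, hadj⟩, ?_⟩
  rw [adjoint_eq (T := (⟨U, W, hadj⟩ : adjointable A E F)) hadj]
  refine ⟨hWU, hUW, fun i => ?_⟩
  simpa [p, q] using hU (Finsupp.single i 1)

end Adjoint

section Total

lemma setOf_eq_range_uncurry {X Y Z : Type*} (b : X → Y → Z) :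
    {z | ∃ x y, z = b x y} = Set.range fun p : X × Y => b p.1 p.2 := by
  ext z
  exact ⟨fun ⟨x, y, h⟩ => ⟨(x, y), h.symm⟩, fun ⟨p, h⟩ => ⟨p.1, p.2, h.symm⟩⟩

variable {A : Type*} [CStarAlgebra A] [PartialOrder A] [StarOrderedRing A]
variable {E : Type*} [NormedAddCommGroup E] [NormedSpace ℂ E] [SMul A E] [CStarModule A E]
variable {F : Type*} [NormedAddCommGroup F] [NormedSpace ℂ F] [SMul A F] [CStarModule A F]

lemma eq_of_inner_eq_on {s : Set E} (hs : (Submodule.span ℂ s).topologicalClosure = ⊤) {x y : E}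
    (h : ∀ z ∈ s, inner A z x = inner A z y) : x = y := by
  have h1 : ∀ x z : E, inner A z x = star (CStarModule.innerSL (A := A) x z) := fun x z => by
    rw [CStarModule.innerSL_apply, CStarModule.star_inner]
  have : CStarModule.innerSL (A := A) x = CStarModule.innerSL (A := A) y :=
    clm_eq_of_span hs fun z hz => star_injective (by rw [← h1, ← h1, h z hz])
  exact eq_of_inner_eq (A := A) fun z => by rw [h1, h1, this]

lemma inner_map_eq_of_span {s : Set E} (hs : (Submodule.span ℂ s).topologicalClosure = ⊤)
    {t : Set F} (ht : (Submodule.span ℂ t).topologicalClosure = ⊤) {S : E →L[ℂ] F}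
    {T : F →L[ℂ] E} (h : ∀ x ∈ s, ∀ y ∈ t, inner A (S x) y = inner A x (T y)) (x : E) (y : F) :
    inner A (S x) y = inner A x (T y) := by
  have h1 : ∀ x ∈ s, ∀ y, inner A (S x) y = inner A x (T y) := fun x hx y => by
    have : CStarModule.innerSL (A := A) (S x) = CStarModule.innerSL (A := A) x ∘L T :=
      clm_eq_of_span ht fun y hy => h x hx y hy
    exact congrArg (fun L => L y) this
  have : CStarModule.innerSL (A := A) y ∘L S = CStarModule.innerSL (A := A) (T y) :=
    clm_eq_of_span hs fun x hx => star_injective (by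
      simpa [CStarModule.innerSL_apply] using h1 x hx y)
  have h2 := congrArg (fun L => star (L x)) this
  simpa [CStarModule.innerSL_apply] using h2

end Total

/-! ### Representations from algebraic actions -/

section Action

variable {A : Type*} [CStarAlgebra A] [PartialOrder A] [StarOrderedRing A]
variable {C : Type*} [CStarAlgebra C]
variable {X : Type*} [AddCommGroup X] [Module ℂ X]
variable {E : Type*} [NormedAddCommGroup E] [NormedSpace ℂ E] [CompleteSpace E]
  [SMul A E] [CStarModule A E]
variable {F : Type*} [AddCommGroup F] [Module ℂ F]

/-- An action of a unital C⋆-algebra on `X` compatible with the inner product of `X ⊗ F` induces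
a representation. Boundedness follows since the algebra is spanned by its unitaries. -/
theorem exists_rep_of_action (ρ : C →ₐ[ℂ] Module.End ℂ X) (τ : X →ₗ[ℂ] F →ₗ[ℂ] E)
    (hτ : (Submodule.span ℂ {e : E | ∃ x f, e = τ x f}).topologicalClosure = ⊤)
    (hadj : ∀ c x y f g, inner A (τ (ρ c x) f) (τ y g) = inner A (τ x f) (τ (ρ (star c) y) g)) :
    ∃ π : C →⋆ₙₐ[ℂ] AdjointableEnd A E, ∀ c x f, (π c).toCLM (τ x f) = τ (ρ c x) f := by
  let S : Submodule ℂ C :=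
    { carrier := {c | ∃ T : E →L[ℂ] E, ∀ x f, T (τ x f) = τ (ρ c x) f}
      add_mem' := by
        rintro c c' ⟨T, hT⟩ ⟨T', hT'⟩
        exact ⟨T + T', fun x f => by simp [hT, hT']⟩
      zero_mem' := ⟨0, by simp⟩
      smul_mem' := by
        rintro z c ⟨T, hT⟩
        exact ⟨z • T, fun x f => by simp [hT]⟩ }
  have hS : ∀ c, c ∈ S := by
    suffices h : (⊤ : Submodule ℂ C) ≤ S from fun c => h Submodule.mem_top
    rw [← CStarAlgebra.span_unitary, Submodule.span_le]
    intro w hw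
    have h1 : ∀ x, ρ (star w) (ρ w x) = x := fun x => by
      rw [← Module.End.mul_apply, ← map_mul, Unitary.star_mul_self_of_mem hw, map_one,
        Module.End.one_apply]
    have h2 : ∀ x, ρ w (ρ (star w) x) = x := fun x => by
      rw [← Module.End.mul_apply, ← map_mul, Unitary.mul_star_self_of_mem hw, map_one,
        Module.End.one_apply]
    -- A unitary `w` only permutes the generators x ⊗ f, and by `hadj` and w⋆w = 1 it preserves
    -- their Gram matrix. So it acts by a unitary operator.
    have hb : (Set.range fun p : X × F => τ (ρ w p.1) p.2) =
        Set.range fun p : X × F => τ p.1 p.2 := by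
      apply Set.Subset.antisymm
      · rintro _ ⟨p, rfl⟩
        exact ⟨(ρ w p.1, p.2), rfl⟩
      · rintro _ ⟨p, rfl⟩
        exact ⟨(ρ (star w) p.1, p.2), by simp [h2]⟩
    rw [setOf_eq_range_uncurry] at hτ
    obtain ⟨U, -, -, hU⟩ := exists_unitary (A := A) (fun p : X × F => τ p.1 p.2)
      (fun p : X × F => τ (ρ w p.1) p.2) hτ (by rw [hb, hτ]) fun p q => by rw [hadj, h1]
    exact ⟨U, fun x f => hU (x, f)⟩
  choose T hT using hS
  have hTadj : ∀ c x y, inner A (T c x) y = inner A x (T (star c) y) := fun c =>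
    inner_map_eq_of_span hτ hτ <| by
      rintro _ ⟨x, f, rfl⟩ _ ⟨y, g, rfl⟩
      rw [hT, hT, hadj]
  have ext' : ∀ {S T : E →L[ℂ] E}, (∀ x f, S (τ x f) = T (τ x f)) → S = T := fun h =>
    clm_eq_of_span hτ (by rintro _ ⟨x, f, rfl⟩; exact h x f)
  refine ⟨{ toFun := fun c => ⟨T c, T (star c), hTadj c⟩
            map_smul' := fun z c => AdjointableEnd.toCLM_injective <| ext' fun x f => ?_
            map_zero' := AdjointableEnd.toCLM_injective <| ext' fun x f => ?_
            map_add' := fun c c' => AdjointableEnd.toCLM_injective <| ext' fun x f => ?_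
            map_mul' := fun c c' => AdjointableEnd.toCLM_injective <| ext' fun x f => ?_
            map_star' := fun c => (AdjointableEnd.star_eq (hTadj c)).symm }, fun c x f => hT c x f⟩
  · change T (z • c) (τ x f) = z • T c (τ x f)
    simp [hT]
  · change T 0 (τ x f) = 0
    simp [hT]
  · change T (c + c') (τ x f) = T c (τ x f) + T c' (τ x f)
    simp [hT]
  · change T (c * c') (τ x f) = T c (T c' (τ x f))
    simp [hT]

end Action

section Bilinear

variable {A : Type*} [CStarAlgebra A] [PartialOrder A] [StarOrderedRing A]

/-- The Kolmogorov decomposition of a kernel on a vector space that is linear in the second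
variable. -/
theorem exists_kolmogorov_linear.{v, w} {X : Type v} [AddCommGroup X] [Module ℂ X] {F : Type w}
    [NormedAddCommGroup F] [NormedSpace ℂ F] [SMul A F] [CStarModule A F]
    (k : X → X →ₗ[ℂ] F →L[ℂ] F)
    (hstar : ∀ x y f g, inner A (k x y f) g = inner A f (k y x g))
    (hpos : ∀ (s : Finset X) (f : X → F), 0 ≤ ∑ x ∈ s, ∑ y ∈ s, inner A (f x) (k x y (f y))) :
    ∃ (E : Type (max v w)) (_ : NormedAddCommGroup E) (_ : NormedSpace ℂ E) (_ : CompleteSpace E)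
      (_ : SMul A E) (_ : CStarModule A E) (τ : X →ₗ[ℂ] F →ₗ[ℂ] E),
      (∀ x y f g, inner A (τ x f) (τ y g) = inner A f (k x y g)) ∧
      (Submodule.span ℂ {e : E | ∃ x f, e = τ x f}).topologicalClosure = ⊤ := by
  obtain ⟨E, i1, i2, i3, i4, i5, τ, hτ, hd⟩ := exists_kolmogorov (fun x y => k x y) hstar hpos
  -- Vectors are determined by inner products against generators, so linearity of `k` in its second
  -- variable passes to `τ`.
  have ext' : ∀ {a b : E}, (∀ x f, inner A (τ x f) a = inner A (τ x f) b) → a = b := fun h =>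
    eq_of_inner_eq_on (A := A) hd (by rintro _ ⟨x, f, rfl⟩; exact h x f)
  exact ⟨E, i1, i2, i3, i4, i5,
    { toFun := τ
      map_add' := fun x y => LinearMap.ext fun f => ext' fun z g => by simp [hτ]
      map_smul' := fun c x => LinearMap.ext fun f => ext' fun z g => by simp [hτ] }, hτ, hd⟩

variable {E : Type*} [NormedAddCommGroup E] [NormedSpace ℂ E] [SMul A E] [CStarModule A E]
variable {F : Type*} [NormedAddCommGroup F] [NormedSpace ℂ F] [SMul A F] [CStarModule A F]

/-- Bounds a linear map before its adjoint is known, using only the bounded operator `T` that plays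
the role of S⋆S. It applies to x ↦ 1 ⊗ x and to creation operators. -/
lemma norm_le_of_inner_self_eq {S : F →ₗ[ℂ] E} {T : F →L[ℂ] F}
    (h : ∀ f, inner A (S f) (S f) = inner A f (T f)) (f : F) : ‖S f‖ ≤ √‖T‖ * ‖f‖ := by
  refine abs_le_of_sq_le_sq' ?_ (by positivity) |>.2
  rw [mul_pow, Real.sq_sqrt (norm_nonneg _)]
  calc ‖S f‖ ^ 2 = ‖inner A f (T f)‖ := by rw [CStarModule.norm_sq_eq A, h]
    _ ≤ ‖f‖ * ‖T f‖ := CStarModule.norm_inner_le F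
    _ ≤ ‖f‖ * (‖T‖ * ‖f‖) := by gcongr; exact T.le_opNorm f
    _ = _ := by ring

end Bilinear

/-! ### Row operators and compressions -/

section Compose

variable {A : Type*} [CStarAlgebra A] [PartialOrder A] [StarOrderedRing A]
variable {E : Type*} [NormedAddCommGroup E] [NormedSpace ℂ E] [SMul A E] [CStarModule A E]
variable {F : Type*} [NormedAddCommGroup F] [NormedSpace ℂ F] [SMul A F] [CStarModule A F]
variable {G : Type*} [NormedAddCommGroup G] [NormedSpace ℂ G] [SMul A G] [CStarModule A G]

/-- Composition of adjointable maps. -/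
def adjointableComp (S : adjointable A F G) (T : adjointable A E F) : adjointable A E G :=
  ⟨(S : F →L[ℂ] G) ∘L (T : E →L[ℂ] F), (adjoint T : F →L[ℂ] E) ∘L (adjoint S : G →L[ℂ] F),
    fun x y => by simp [inner_adjoint]⟩

@[simp] lemma coe_adjointableComp (S : adjointable A F G) (T : adjointable A E F) :
    (adjointableComp S T : E →L[ℂ] G) = (S : F →L[ℂ] G) ∘L (T : E →L[ℂ] F) := rfl

lemma coe_adjoint_adjointableComp (S : adjointable A F G) (T : adjointable A E F) :
    (adjoint (adjointableComp S T) : G →L[ℂ] E) =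
      (adjoint T : F →L[ℂ] E) ∘L (adjoint S : G →L[ℂ] F) :=
  adjoint_eq fun x y => by simp [inner_adjoint]

@[simp] lemma adjoint_adjoint (T : adjointable A E F) : adjoint (adjoint T) = T :=
  Subtype.ext <| adjoint_eq fun x y => adjoint_inner T x y

/-- The row operator `(x j)_j ↦ ∑ j, T j (x j)`. -/
def rowMap {ι : Type*} [Fintype ι] (T : ι → adjointable A F E) :
    adjointable A C⋆ᵐᵒᵈ(A, ι → F) E :=
  ⟨(∑ j, (T j : F →L[ℂ] E) ∘L ContinuousLinearMap.proj j) ∘L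
      (WithCStarModule.equivL ℂ : C⋆ᵐᵒᵈ(A, ι → F) ≃L[ℂ] (ι → F)),
    ((WithCStarModule.equivL ℂ : C⋆ᵐᵒᵈ(A, ι → F) ≃L[ℂ] (ι → F)).symm :
        (ι → F) →L[ℂ] C⋆ᵐᵒᵈ(A, ι → F)) ∘L
      ContinuousLinearMap.pi fun i => (adjoint (T i) : E →L[ℂ] F),
    fun x y => by
      simp [WithCStarModule.pi_inner, sum_apply, inner_adjoint]⟩

lemma rowMap_apply {ι : Type*} [Fintype ι] (T : ι → adjointable A F E) (x : C⋆ᵐᵒᵈ(A, ι → F)) :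
    (rowMap T : C⋆ᵐᵒᵈ(A, ι → F) →L[ℂ] E) x = ∑ j, (T j : F →L[ℂ] E) (x j) := by
  simp [rowMap, sum_apply]

lemma adjoint_rowMap_apply {ι : Type*} [Fintype ι] (T : ι → adjointable A F E) (e : E) (i : ι) :
    (adjoint (rowMap T) : E →L[ℂ] C⋆ᵐᵒᵈ(A, ι → F)) e i = (adjoint (T i) : E →L[ℂ] F) e := by
  classical
  refine eq_of_inner_eq (A := A) fun f => ?_
  have h := inner_adjoint (rowMap T) ((WithCStarModule.equiv A (ι → F)).symm (Pi.single i f)) e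
  rw [WithCStarModule.inner_single_left, rowMap_apply] at h
  rw [← h, ← inner_adjoint, Finset.sum_eq_single i]
  · simp
  · intro j _ hj
    simp [hj]
  · simp

variable [CompleteSpace E] [CompleteSpace F]
variable {C : Type*} [CStarAlgebra C] [PartialOrder C] [StarOrderedRing C]

/-- The adjointable operator `W⋆ T W`. -/
def conjEnd (W : adjointable A F E) (T : AdjointableEnd A E) : AdjointableEnd A F :=
  ⟨(adjoint W : E →L[ℂ] F) ∘L T.toCLM ∘L (W : F →L[ℂ] E),
    (adjoint W : E →L[ℂ] F) ∘L (star T).toCLM ∘L (W : F →L[ℂ] E), fun x y => by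
      simp [adjoint_inner, ← inner_adjoint, AdjointableEnd.inner_star]⟩

lemma toCLM_conjEnd (W : adjointable A F E) (T : AdjointableEnd A E) :
    (conjEnd W T).toCLM = (adjoint W : E →L[ℂ] F) ∘L T.toCLM ∘L (W : F →L[ℂ] E) := rfl

lemma inner_conjEnd (W : adjointable A F E) (T : AdjointableEnd A E) (x y : F) :
    inner A x ((conjEnd W T).toCLM y) =
      inner A ((W : F →L[ℂ] E) x) (T.toCLM ((W : F →L[ℂ] E) y)) :=
  (inner_adjoint W _ _).symm

lemma star_conjEnd (W : adjointable A F E) (T : AdjointableEnd A E) :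
    star (conjEnd W T) = conjEnd W (star T) :=
  AdjointableEnd.star_eq fun x y => by
    rw [inner_conjEnd, AdjointableEnd.inner_toCLM_star, ← CStarModule.star_inner, inner_conjEnd,
      CStarModule.star_inner]

/-- The quadratic form of the compressed matrix at x is that of `M` at (W x_i)_i. -/
lemma matrix_conjEnd_nonneg (W : adjointable A F E) {ι : Type*} [Fintype ι]
    {M : CStarMatrix ι ι (AdjointableEnd A E)} (hM : 0 ≤ M) :
    0 ≤ M.map (conjEnd W) := by
  refine AdjointableEnd.matrix_nonneg (CStarMatrix.ext fun i j => ?_) fun x => ?_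
  · rw [CStarMatrix.star_apply, CStarMatrix.map_apply, CStarMatrix.map_apply, star_conjEnd,
      ← CStarMatrix.star_apply, hM.isSelfAdjoint.star_eq]
  · simp only [CStarMatrix.map_apply, inner_conjEnd]
    exact AdjointableEnd.inner_matrix_nonneg hM fun i => (W : F →L[ℂ] E) (x i)

/-- The completely positive map `c ↦ W⋆ π(c) W`. -/
def conjCP (π : C →⋆ₙₐ[ℂ] AdjointableEnd A E) (W : adjointable A F E) :
    C →CP AdjointableEnd A F where
  toFun c := conjEnd W (π c)
  map_add' c c' := AdjointableEnd.toCLM_injective <| by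
    ext x
    simp [toCLM_conjEnd]
  map_smul' z c := AdjointableEnd.toCLM_injective <| by
    ext x
    simp [toCLM_conjEnd]
  map_cstarMatrix_nonneg' k M hM :=
    matrix_conjEnd_nonneg W (CompletelyPositiveMapClass.map_cstarMatrix_nonneg' π k M hM)

lemma toCLM_conjCP (π : C →⋆ₙₐ[ℂ] AdjointableEnd A E) (W : adjointable A F E) (c : C) :
    (conjCP π W c).toCLM = (adjoint W : E →L[ℂ] F) ∘L (π c).toCLM ∘L (W : F →L[ℂ] E) := rfl

end Compose

/-! ### Positive kernels from Gram matrices -/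

section Gram

variable {D : Type*} [CStarAlgebra D] [PartialOrder D] [StarOrderedRing D]

/-- The quadratic form at a is z⋆z with z = ∑ x_i a_i. -/
lemma cstarMatrix_star_mul_nonneg {ι : Type*} [Fintype ι] (x : ι → D) :
    0 ≤ (CStarMatrix.ofMatrix fun i j => star (x i) * x j : CStarMatrix ι ι D) := by
  refine cstarMatrix_nonneg (CStarMatrix.ext fun i j => ?_) fun a => ?_
  · rw [CStarMatrix.star_apply]
    change star (star (x j) * x i) = star (x i) * x j
    rw [star_mul, star_star]
  · have : ∑ i, ∑ j, star (a i) * (star (x i) * x j) * a j =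
        star (∑ i, x i * a i) * ∑ j, x j * a j := by
      simp [star_sum, Finset.sum_mul_sum, mul_assoc]
    exact (star_mul_self_nonneg _).trans_eq this.symm

/-- The quadratic form at a is ⟨z, z⟩_D with z = ∑ y_i · a_i. -/
lemma cstarMatrix_rightInner_nonneg {Y : Type*} [NormedAddCommGroup Y] [NormedSpace ℂ Y]
    [SMul Dᵐᵒᵖ Y] [CStarModule Dᵐᵒᵖ Y] {ι : Type*} [Fintype ι] (y : ι → Y) :
    0 ≤ (CStarMatrix.ofMatrix fun i j => rightInner D (y i) (y j) : CStarMatrix ι ι D) := by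
  refine cstarMatrix_nonneg (CStarMatrix.ext fun i j => ?_) fun a => ?_
  · rw [CStarMatrix.star_apply]
    change star (rightInner D (y j) (y i)) = rightInner D (y i) (y j)
    rw [rightInner, ← MulOpposite.unop_star, CStarModule.star_inner]
  · have : ∑ i, ∑ j, star (a i) * rightInner D (y i) (y j) * a j =
        rightInner D (∑ i, MulOpposite.op (a i) • y i) (∑ j, MulOpposite.op (a j) • y j) := by
      rw [Finset.sum_comm]
      simp [rightInner, Finset.sum_mul, mul_assoc]
    refine le_of_le_of_eq ?_ this.symm
    exact MulOpposite.unop_nonneg.mpr CStarModule.inner_self_nonneg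

variable {A : Type*} [CStarAlgebra A] [PartialOrder A] [StarOrderedRing A]
variable {F : Type*} [NormedAddCommGroup F] [NormedSpace ℂ F] [CompleteSpace F]
  [SMul A F] [CStarModule A F]

/-- Complete positivity of `θ` turns a positive matrix over `D` into the positivity hypothesis of
the Kolmogorov decomposition. -/
lemma inner_kernel_nonneg (θ : D →CP AdjointableEnd A F) {X : Type*} (K : X → X → D)
    (s : Finset X) (hK : 0 ≤ (CStarMatrix.ofMatrix fun i j => K i j : CStarMatrix s s D))
    (f : X → F) : 0 ≤ ∑ x ∈ s, ∑ y ∈ s, inner A (f x) ((θ (K x y)).toCLM (f y)) := by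
  have h := AdjointableEnd.inner_matrix_nonneg (θ.map_cstarMatrix_nonneg _ hK) fun i => f i
  rw [← Finset.sum_coe_sort s]
  simp only [← Finset.sum_coe_sort s fun y => inner A (f _) ((θ (K _ y)).toCLM (f y))]
  exact h

end Gram

/-- The algebra action underlying a Hilbert module. -/
def actionHom (A E : Type*) [CStarAlgebra A] [PartialOrder A] [StarOrderedRing A]
    [NormedAddCommGroup E] [NormedSpace ℂ E] [SMul A E] [CStarModule A E] :
    A →ₐ[ℂ] Module.End ℂ E :=
  AlgHom.ofLinearMap
    { toFun := fun a =>
        { toFun := fun x => a • x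
          map_add' := fun x y => eq_of_inner_eq (A := A) fun z => by simp [mul_add]
          map_smul' := fun c x => eq_of_inner_eq (A := A) fun z => by simp }
      map_add' := fun a b => LinearMap.ext fun x => eq_of_inner_eq (A := A) fun z => by
        simp [add_mul]
      map_smul' := fun c a => LinearMap.ext fun x => eq_of_inner_eq (A := A) fun z => by simp }
    (LinearMap.ext fun x => eq_of_inner_eq (A := A) fun z => by simp)
    (fun a b => LinearMap.ext fun x => eq_of_inner_eq (A := A) fun z => by simp [mul_assoc])

@[simp] lemma actionHom_apply {A E : Type*} [CStarAlgebra A] [PartialOrder A] [StarOrderedRing A]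
    [NormedAddCommGroup E] [NormedSpace ℂ E] [SMul A E] [CStarModule A E] (a : A) (x : E) :
    actionHom A E a x = a • x := rfl

/-! ### Existence and uniqueness of minimal KSGNS-representations -/

section KSGNS

/-- Existence of a minimal KSGNS-representation. -/
theorem exists_minimalKSGNS {B : Type uB} [CStarAlgebra B] [PartialOrder B]
    [StarOrderedRing B] {D : Type uD} [CStarAlgebra D] [PartialOrder D] [StarOrderedRing D]
    {F : Type uF} [NormedAddCommGroup F] [NormedSpace ℂ F] [CompleteSpace F]
    [SMul Bᵐᵒᵖ F] [CStarModule Bᵐᵒᵖ F] (ψ : D →CP AdjointableEnd Bᵐᵒᵖ F) :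
    ∃ (G : Type (max uD uF)) (_ : NormedAddCommGroup G) (_ : NormedSpace ℂ G)
      (_ : CompleteSpace G) (_ : SMul Bᵐᵒᵖ G) (_ : CStarModule Bᵐᵒᵖ G)
      (π : D →⋆ₙₐ[ℂ] AdjointableEnd Bᵐᵒᵖ G) (V : adjointable Bᵐᵒᵖ F G), IsMinimalKSGNS ψ π V := by
  have hψ : ∀ d, star (ψ d) = ψ (star d) := fun d => (map_star ψ d).symm
  obtain ⟨G, i1, i2, i3, i4, i5, τ, hτ, hd⟩ := exists_kolmogorov_linear (A := Bᵐᵒᵖ)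
    (X := D) (F := F)
    (fun x =>
      { toFun := fun y => (ψ (star x * y)).toCLM
        map_add' := fun y z => by rw [mul_add, map_add, AdjointableEnd.toCLM_add]
        map_smul' := fun c y => by rw [mul_smul_comm, map_smul]; rfl })
    (fun x y f g => by
      change inner _ ((ψ (star x * y)).toCLM f) g = inner _ f ((ψ (star y * x)).toCLM g)
      rw [AdjointableEnd.inner_star, hψ, star_mul, star_star])
    (fun s f => inner_kernel_nonneg ψ (fun x y => star x * y) s (cstarMatrix_star_mul_nonneg _) f)
  replace hτ : ∀ x y f g, inner Bᵐᵒᵖ (τ x f) (τ y g) = inner _ f ((ψ (star x * y)).toCLM g) := hτ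
  obtain ⟨π, hπ⟩ := exists_rep_of_action (A := Bᵐᵒᵖ) (Algebra.lmul ℂ D) τ hd fun c x y f g => by
    rw [hτ, hτ]
    simp [mul_assoc]
  -- V is f ↦ 1 ⊗ f, and its adjoint sends d ⊗ f to ψ(d)f.
  let V₀ : F →L[ℂ] G := (τ 1).mkContinuous _
    (norm_le_of_inner_self_eq (A := Bᵐᵒᵖ) fun f => hτ 1 1 f f)
  have hV₀ : ∀ f, V₀ f = τ 1 f := fun _ => rfl
  have hV : V₀ ∈ adjointable Bᵐᵒᵖ F G := mem_adjointable_of_span V₀ hd <| by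
    rintro _ ⟨d, f, rfl⟩
    exact ⟨(ψ d).toCLM f, fun x => by rw [hV₀, hτ, star_one, one_mul]⟩
  have hπV : ∀ d f, (π d).toCLM (V₀ f) = τ d f := fun d f => by
    rw [hV₀, hπ]; simp
  refine ⟨G, i1, i2, i3, i4, i5, π, ⟨V₀, hV⟩, fun d => ?_, ?_⟩
  · ext f
    refine eq_of_inner_eq (A := Bᵐᵒᵖ) fun g => ?_
    rw [ContinuousLinearMap.comp_apply, ContinuousLinearMap.comp_apply, ← inner_adjoint]
    change _ = inner _ (V₀ g) ((π d).toCLM (V₀ f))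
    rw [hπV, hV₀, hτ, star_one, one_mul]
  · simpa only [hπV] using hd

variable {B : Type*} [CStarAlgebra B] [PartialOrder B] [StarOrderedRing B]
variable {D : Type*} [CStarAlgebra D] [PartialOrder D] [StarOrderedRing D]
variable {F : Type*} [NormedAddCommGroup F] [NormedSpace ℂ F] [CompleteSpace F]
  [SMul Bᵐᵒᵖ F] [CStarModule Bᵐᵒᵖ F]
variable {E : Type*} [NormedAddCommGroup E] [NormedSpace ℂ E] [CompleteSpace E]
  [SMul Bᵐᵒᵖ E] [CStarModule Bᵐᵒᵖ E]
variable {G : Type*} [NormedAddCommGroup G] [NormedSpace ℂ G] [CompleteSpace G]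
  [SMul Bᵐᵒᵖ G] [CStarModule Bᵐᵒᵖ G]

lemma IsMinimalKSGNS.isNondegenerate {ψ : D →CP AdjointableEnd Bᵐᵒᵖ F}
    {π : D →⋆ₙₐ[ℂ] AdjointableEnd Bᵐᵒᵖ E} {V : adjointable Bᵐᵒᵖ F E} (h : IsMinimalKSGNS ψ π V) :
    IsNondegenerate π := by
  rw [IsNondegenerate, eq_top_iff, ← h.dense_span]
  refine Submodule.topologicalClosure_mono (Submodule.span_mono ?_)
  rintro _ ⟨d, f, rfl⟩
  exact ⟨d, _, rfl⟩

/-- The Gram matrix of the generators π(c)Vf depends on `ψ` alone, which forces uniqueness. -/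
lemma IsMinimalKSGNS.inner_eq {ψ : D →CP AdjointableEnd Bᵐᵒᵖ F}
    {π : D →⋆ₙₐ[ℂ] AdjointableEnd Bᵐᵒᵖ E} {V : adjointable Bᵐᵒᵖ F E} (h : IsMinimalKSGNS ψ π V)
    (c d : D) (f g : F) :
    inner Bᵐᵒᵖ ((π c).toCLM ((V : F →L[ℂ] E) f)) ((π d).toCLM ((V : F →L[ℂ] E) g)) =
      inner Bᵐᵒᵖ f ((ψ (star c * d)).toCLM g) := by
  rw [h.eq_conj, ContinuousLinearMap.comp_apply, ContinuousLinearMap.comp_apply, ← inner_adjoint,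
    map_mul, map_star, AdjointableEnd.inner_star]
  rfl

/-- Minimal KSGNS-representations are unique up to unitary equivalence. -/
theorem IsMinimalKSGNS.unitarilyEquivalent {ψ : D →CP AdjointableEnd Bᵐᵒᵖ F}
    {π : D →⋆ₙₐ[ℂ] AdjointableEnd Bᵐᵒᵖ E} {V : adjointable Bᵐᵒᵖ F E} (h : IsMinimalKSGNS ψ π V)
    {ρ : D →⋆ₙₐ[ℂ] AdjointableEnd Bᵐᵒᵖ G} {W : adjointable Bᵐᵒᵖ F G}
    (h' : IsMinimalKSGNS ψ ρ W) : UnitarilyEquivalent π ρ := by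
  have hd := h.dense_span
  have hd' := h'.dense_span
  obtain ⟨U, hU1, hU2, hU⟩ := exists_unitary (A := Bᵐᵒᵖ)
    (fun p : D × F => (π p.1).toCLM ((V : F →L[ℂ] E) p.2))
    (fun p : D × F => (ρ p.1).toCLM ((W : F →L[ℂ] G) p.2)) (by rw [← hd, setOf_eq_range_uncurry])
    (by rw [← hd', setOf_eq_range_uncurry]) fun p q => by rw [h.inner_eq, h'.inner_eq]
  refine ⟨U, hU1, hU2, fun c => ?_⟩
  have key : (ρ c).toCLM ∘L (U : E →L[ℂ] G) = (U : E →L[ℂ] G) ∘L (π c).toCLM := by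
    refine clm_eq_of_span hd ?_
    rintro _ ⟨d, f, rfl⟩
    have h1 := hU (d, f)
    have h2 := hU (c * d, f)
    rw [map_mul, map_mul] at h2
    exact (congrArg (ρ c).toCLM h1).trans h2.symm
  rw [← ContinuousLinearMap.comp_assoc, ← key, ContinuousLinearMap.comp_assoc, hU2,
    ContinuousLinearMap.comp_id]

end KSGNS

/-! ### Interior tensor products and induced representations -/

section Tensor

/-- Existence of the interior tensor product. -/
theorem exists_isInteriorTensorProduct {B : Type uB} [CStarAlgebra B]
    [PartialOrder B] [StarOrderedRing B] {D : Type uD} [CStarAlgebra D] [PartialOrder D]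
    [StarOrderedRing D] {Y : Type uY} [NormedAddCommGroup Y] [NormedSpace ℂ Y] [SMul Dᵐᵒᵖ Y]
    [CStarModule Dᵐᵒᵖ Y] {F : Type uF} [NormedAddCommGroup F] [NormedSpace ℂ F] [CompleteSpace F]
    [SMul Bᵐᵒᵖ F] [CStarModule Bᵐᵒᵖ F] (π : D →⋆ₙₐ[ℂ] AdjointableEnd Bᵐᵒᵖ F) :
    ∃ (E : Type (max uY uF)) (_ : NormedAddCommGroup E) (_ : NormedSpace ℂ E)
      (_ : CompleteSpace E) (_ : SMul Bᵐᵒᵖ E) (_ : CStarModule Bᵐᵒᵖ E)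
      (τ : Y →ₗ[ℂ] F →ₗ[ℂ] E), IsInteriorTensorProduct π τ := by
  obtain ⟨E, i1, i2, i3, i4, i5, τ, hτ, hd⟩ := exists_kolmogorov_linear (A := Bᵐᵒᵖ)
    (X := Y) (F := F)
    (fun x =>
      { toFun := fun y => (π (rightInner D x y)).toCLM
        map_add' := fun y z => by simp [rightInner]
        map_smul' := fun c y => by simp [rightInner] })
    (fun x y f g => by
      change inner _ ((π (rightInner D x y)).toCLM f) g =
        inner _ f ((π (rightInner D y x)).toCLM g)
      rw [AdjointableEnd.inner_star, ← map_star, rightInner, ← unop_star, CStarModule.star_inner])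
    (fun s f => inner_kernel_nonneg
      (CompletelyPositiveMapClass.toCompletelyPositiveLinearMap π) (fun x y => rightInner D x y) s
      (cstarMatrix_rightInner_nonneg _) f)
  exact ⟨E, i1, i2, i3, i4, i5, τ, fun y z f g => congrArg unop (hτ y z f g), hd⟩

variable {B : Type*} [CStarAlgebra B] [PartialOrder B] [StarOrderedRing B]
variable {C : Type*} [CStarAlgebra C] [PartialOrder C] [StarOrderedRing C]
variable {D : Type*} [CStarAlgebra D] [PartialOrder D] [StarOrderedRing D]
variable {E : Type*} [NormedAddCommGroup E] [NormedSpace ℂ E] [CompleteSpace E]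
  [SMul Bᵐᵒᵖ E] [CStarModule Bᵐᵒᵖ E]
variable {F : Type*} [NormedAddCommGroup F] [NormedSpace ℂ F] [CompleteSpace F]
  [SMul Bᵐᵒᵖ F] [CStarModule Bᵐᵒᵖ F]
variable {G : Type*} [NormedAddCommGroup G] [NormedSpace ℂ G] [CompleteSpace G]
  [SMul Bᵐᵒᵖ G] [CStarModule Bᵐᵒᵖ G]
variable {H : Type*} [NormedAddCommGroup H] [NormedSpace ℂ H] [CompleteSpace H]
  [SMul Bᵐᵒᵖ H] [CStarModule Bᵐᵒᵖ H]
variable {Y : Type*} [NormedAddCommGroup Y] [NormedSpace ℂ Y] [SMul C Y] [SMul Dᵐᵒᵖ Y]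
  [CStarModule C Y] [CStarModule Dᵐᵒᵖ Y]
variable {π : D →⋆ₙₐ[ℂ] AdjointableEnd Bᵐᵒᵖ G} {τ : Y →ₗ[ℂ] G →ₗ[ℂ] E}

namespace IsInteriorTensorProduct

lemma inner_tmul (h : IsInteriorTensorProduct π τ) (y z : Y) (f g : G) :
    inner Bᵐᵒᵖ (τ y f) (τ z g) = inner Bᵐᵒᵖ f ((π (rightInner D y z)).toCLM g) :=
  unop_injective (h.rightInner_tmul y z f g)

lemma ext_inner (h : IsInteriorTensorProduct π τ) {a b : E}
    (hab : ∀ y f, inner Bᵐᵒᵖ (τ y f) a = inner Bᵐᵒᵖ (τ y f) b) : a = b :=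
  eq_of_inner_eq_on (A := Bᵐᵒᵖ) h.dense_span (by rintro _ ⟨y, f, rfl⟩; exact hab y f)

/-- Balancing over `D` is not part of the definition. It follows because both sides have the same
inner products with all generators. -/
lemma tmul_op_smul (h : IsInteriorTensorProduct π τ) (y : Y) (d : D) (f : G) :
    τ (op d • y) f = τ y ((π d).toCLM f) :=
  h.ext_inner fun z g => by
    rw [h.inner_tmul, h.inner_tmul, rightInner, CStarModule.inner_op_smul_right, unop_mul,
      unop_op, map_mul]
    rfl

/-- The creation operators `y ↦ (f ↦ y ⊗ f)`. -/
def creation (h : IsInteriorTensorProduct π τ) : Y →ₗ[ℂ] adjointable Bᵐᵒᵖ G E where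
  toFun y := ⟨(τ y).mkContinuous _ (norm_le_of_inner_self_eq (A := Bᵐᵒᵖ)
      fun f => h.inner_tmul y y f f),
    mem_adjointable_of_span _ h.dense_span <| by
      rintro _ ⟨z, g, rfl⟩
      exact ⟨(π (rightInner D y z)).toCLM g, fun f => h.inner_tmul y z f g⟩⟩
  map_add' y z := Subtype.ext <| ContinuousLinearMap.ext fun f => by simp
  map_smul' c y := Subtype.ext <| ContinuousLinearMap.ext fun f => by simp

@[simp] lemma creation_apply (h : IsInteriorTensorProduct π τ) (y : Y) (f : G) :
    (h.creation y : G →L[ℂ] E) f = τ y f := rfl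

lemma adjoint_creation_apply (h : IsInteriorTensorProduct π τ) (y z : Y) (g : G) :
    (adjoint (h.creation y) : E →L[ℂ] G) (τ z g) = (π (rightInner D y z)).toCLM g :=
  eq_of_inner_eq (A := Bᵐᵒᵖ) fun f => by
    rw [← inner_adjoint, creation_apply, h.inner_tmul]

/-- On generators, T_y T_z⋆ (x ⊗ g) = y⟨z, x⟩_D ⊗ g = _C⟨y, z⟩x ⊗ g, by balancing and compatibility
of the two inner products. -/
lemma isMoritaIntertwiner (hY : IsEquivalenceBimodule C D Y) (h : IsInteriorTensorProduct π τ)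
    {πC : C →⋆ₙₐ[ℂ] AdjointableEnd Bᵐᵒᵖ E}
    (hC : ∀ (c : C) (y : Y) (f : G), (πC c).toCLM (τ y f) = τ (c • y) f) :
    IsMoritaIntertwiner πC π h.creation where
  mul_adjoint y z := clm_eq_of_span h.dense_span <| by
    rintro _ ⟨x, g, rfl⟩
    rw [ContinuousLinearMap.comp_apply, h.adjoint_creation_apply, h.creation_apply, hC,
      hY.leftInner_smul_eq, h.tmul_op_smul]
  adjoint_mul y z := ContinuousLinearMap.ext fun g => by
    rw [ContinuousLinearMap.comp_apply, h.creation_apply, h.adjoint_creation_apply]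
  map_smul_smul c y d := ContinuousLinearMap.ext fun g => by
    simp [hC, hY.smul_op_smul, h.tmul_op_smul]

/-- The interior tensor product carries the induced representation. -/
theorem exists_inducedRep (hY : IsEquivalenceBimodule C D Y) (h : IsInteriorTensorProduct π τ) :
    ∃ πC : C →⋆ₙₐ[ℂ] AdjointableEnd Bᵐᵒᵖ E,
      ∀ (c : C) (y : Y) (f : G), (πC c).toCLM (τ y f) = τ (c • y) f :=
  exists_rep_of_action (A := Bᵐᵒᵖ) (actionHom C Y) τ h.dense_span fun c x y f g => by
    rw [h.inner_tmul, h.inner_tmul, actionHom_apply, actionHom_apply, hY.rightInner_smul]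

end IsInteriorTensorProduct

/-- Compose with the unitary: ρ_Y(y) = U⋆ π_Y(y). -/
lemma IsMoritaIntertwiner.of_unitarilyEquivalent {πC : C →⋆ₙₐ[ℂ] AdjointableEnd Bᵐᵒᵖ E}
    {πY : Y →ₗ[ℂ] adjointable Bᵐᵒᵖ G E} (h : IsMoritaIntertwiner πC π πY)
    {ρ : C →⋆ₙₐ[ℂ] AdjointableEnd Bᵐᵒᵖ H} (hρ : UnitarilyEquivalent ρ πC) :
    ∃ ρY : Y →ₗ[ℂ] adjointable Bᵐᵒᵖ G H, IsMoritaIntertwiner ρ π ρY := by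
  obtain ⟨U, hU1, hU2, hU⟩ := hρ
  have h1 : ∀ x, (adjoint U : E →L[ℂ] H) ((U : H →L[ℂ] E) x) = x := fun x =>
    congrArg (fun T => T x) hU1
  have h2 : ∀ x, (U : H →L[ℂ] E) ((adjoint U : E →L[ℂ] H) x) = x := fun x =>
    congrArg (fun T => T x) hU2
  refine ⟨{ toFun := fun y => adjointableComp (adjoint U) (πY y)
            map_add' := fun y z => Subtype.ext <| ContinuousLinearMap.ext fun g => by simp
            map_smul' := fun c y => Subtype.ext <| ContinuousLinearMap.ext fun g => by simp },
    fun y z => ?_, fun y z => ?_, fun c y d => ?_⟩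
  · change (adjointableComp (adjoint U) (πY y) : G →L[ℂ] H) ∘L
      (adjoint (adjointableComp (adjoint U) (πY z)) : H →L[ℂ] G) = _
    ext x
    have := congrArg (fun T => T ((U : H →L[ℂ] E) x)) (h.mul_adjoint y z)
    rw [coe_adjoint_adjointableComp]
    simp only [hU, ContinuousLinearMap.comp_apply, h1] at this
    simp [this, h1]
  · change (adjoint (adjointableComp (adjoint U) (πY y)) : H →L[ℂ] G) ∘L
      (adjointableComp (adjoint U) (πY z) : G →L[ℂ] H) = _
    rw [coe_adjoint_adjointableComp, ← h.adjoint_mul]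
    ext x
    simp [h2]
  · change (adjointableComp (adjoint U) (πY (c • (op d • y))) : G →L[ℂ] H) =
      (ρ c).toCLM ∘L (adjointableComp (adjoint U) (πY y) : G →L[ℂ] H) ∘L (π d).toCLM
    ext x
    simp [h.map_smul_smul, hU, h1]

lemma IsMinimalKSGNS.conj_rowMap_creation_apply {ψ : D →CP AdjointableEnd Bᵐᵒᵖ F}
    {V : adjointable Bᵐᵒᵖ F G} (hV : IsMinimalKSGNS ψ π V) (h : IsInteriorTensorProduct π τ)
    {πC : C →⋆ₙₐ[ℂ] AdjointableEnd Bᵐᵒᵖ E}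
    (hC : ∀ (c : C) (y : Y) (f : G), (πC c).toCLM (τ y f) = τ (c • y) f)
    {n : ℕ} (u : Fin n → Y) (c : C) (x : C⋆ᵐᵒᵈ(Bᵐᵒᵖ, Fin n → F)) (i : Fin n) :
    (conjCP πC (rowMap fun j => adjointableComp (h.creation (u j)) V) c).toCLM x i =
      ∑ j, (ψ (rightInner D (u i) (c • u j))).toCLM (x j) := by
  simp only [toCLM_conjCP, ContinuousLinearMap.comp_apply, adjoint_rowMap_apply, rowMap_apply,
    coe_adjoint_adjointableComp, coe_adjointableComp, h.creation_apply, map_sum, hC,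
    h.adjoint_creation_apply, hV.eq_conj]

/-- The representation induced from a minimal KSGNS-representation `(π, V, G)` of `ψ` is a minimal
KSGNS-representation of every `φ` with matrix entries `ψ ⟨u i, c · u j⟩_D`. -/
theorem IsMinimalKSGNS.induced {ψ : D →CP AdjointableEnd Bᵐᵒᵖ F} {V : adjointable Bᵐᵒᵖ F G}
    (hV : IsMinimalKSGNS ψ π V) (h : IsInteriorTensorProduct π τ)
    {πC : C →⋆ₙₐ[ℂ] AdjointableEnd Bᵐᵒᵖ E}
    (hC : ∀ (c : C) (y : Y) (f : G), (πC c).toCLM (τ y f) = τ (c • y) f)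
    {n : ℕ} {u : Fin n → Y} (hu : IsLeftBasis C u)
    {φ : C →CP AdjointableEnd Bᵐᵒᵖ C⋆ᵐᵒᵈ(Bᵐᵒᵖ, Fin n → F)}
    (hφ : ∀ (c : C) (x : C⋆ᵐᵒᵈ(Bᵐᵒᵖ, Fin n → F)) (i : Fin n),
      (φ c).toCLM x i = ∑ j, (ψ (rightInner D (u i) (c • u j))).toCLM (x j)) :
    IsMinimalKSGNS φ πC (rowMap fun j => adjointableComp (h.creation (u j)) V) := by
  refine ⟨fun c => ContinuousLinearMap.ext fun x => WithCStarModule.ext fun i => ?_, ?_⟩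
  · rw [hφ, ← hV.conj_rowMap_creation_apply h hC u c x i]
    rfl
  · set P : Submodule ℂ E := (Submodule.span ℂ _).topologicalClosure with hP
    have hPc : IsClosed (P : Set E) := Submodule.isClosed_topologicalClosure _
    -- Expand `y` in the basis: each term _C⟨y, u_i⟩u_i ⊗ Vf is π_C(_C⟨y, u_i⟩) applied to the row
    -- operator at `f` placed in slot `i`.
    have h1 : ∀ y f, τ y ((V : F →L[ℂ] G) f) ∈ P := fun y f => by
      rw [hu y, map_sum, LinearMap.sum_apply]
      refine Submodule.sum_mem _ fun i _ => Submodule.le_topologicalClosure _ <|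
        Submodule.subset_span ⟨leftInner C y (u i),
          (WithCStarModule.equiv Bᵐᵒᵖ (Fin n → F)).symm (Pi.single i f), ?_⟩
      rw [rowMap_apply, Finset.sum_eq_single i]
      · simp [hC]
      · intro j _ hj
        simp [hj]
      · simp
    -- By continuity of y ⊗ · it is enough to take g = π(d)Vf, and π(d) moves across the tensor sign
    -- onto `y`.
    have h2 : ∀ y g, τ y g ∈ P := fun y g => by
      have hle : (⊤ : Submodule ℂ G) ≤ P.comap (h.creation y : G →L[ℂ] E).toLinearMap := by
        rw [← hV.dense_span]
        refine Submodule.topologicalClosure_minimal _ (Submodule.span_le.mpr ?_)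
          (hPc.preimage (h.creation y : G →L[ℂ] E).continuous)
        rintro _ ⟨d, f, rfl⟩
        change τ y ((π d).toCLM ((V : F →L[ℂ] G) f)) ∈ P
        rw [← h.tmul_op_smul]
        exact h1 _ _
      exact hle Submodule.mem_top
    rw [eq_top_iff, ← h.dense_span]
    refine Submodule.topologicalClosure_minimal _ (Submodule.span_le.mpr ?_) hPc
    rintro _ ⟨y, g, rfl⟩
    exact h2 y g

end Tensor

end HilbertModule

end

/-! ### The main theorem -/

open HilbertModule
theorem theorem3p5
    {B : Type uB} [CStarAlgebra B] [PartialOrder B] [StarOrderedRing B]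
    {C : Type uC} [CStarAlgebra C] [PartialOrder C] [StarOrderedRing C]
    {D : Type uD} [CStarAlgebra D] [PartialOrder D] [StarOrderedRing D]
    {Y : Type uY} [NormedAddCommGroup Y] [NormedSpace ℂ Y] [SMul C Y] [SMul Dᵐᵒᵖ Y]
    [CStarModule C Y] [CStarModule Dᵐᵒᵖ Y] (hY : HilbertModule.IsEquivalenceBimodule C D Y)
    {n : ℕ} (u : Fin n → Y) (hu : HilbertModule.IsLeftBasis C u)
    {F : Type uF} [NormedAddCommGroup F] [NormedSpace ℂ F] [CompleteSpace F]
    [SMul Bᵐᵒᵖ F] [CStarModule Bᵐᵒᵖ F]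
    (ψ : D →CP HilbertModule.AdjointableEnd Bᵐᵒᵖ F) :
    ∃ φ : C →CP HilbertModule.AdjointableEnd Bᵐᵒᵖ C⋆ᵐᵒᵈ(Bᵐᵒᵖ, Fin n → F),
      (∀ (c : C) (x : C⋆ᵐᵒᵈ(Bᵐᵒᵖ, Fin n → F)) (i : Fin n),
        (φ c).toCLM x i =
          ∑ j, (ψ (HilbertModule.rightInner D (u i) (c • u j))).toCLM (x j)) ∧
      HilbertModule.StronglyMoritaEquivalent.{uY} φ ψ ∧
      -- the representation induced on the interior tensor product, for any minimal
      -- KSGNS-representation `(πψ, Vψ, G)` for `ψ`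
      ∀ (G : Type uG) [NormedAddCommGroup G] [NormedSpace ℂ G] [CompleteSpace G]
        [SMul Bᵐᵒᵖ G] [CStarModule Bᵐᵒᵖ G]
        (πψ : D →⋆ₙₐ[ℂ] HilbertModule.AdjointableEnd Bᵐᵒᵖ G)
        (Vψ : HilbertModule.adjointable Bᵐᵒᵖ F G),
        HilbertModule.IsMinimalKSGNS ψ πψ Vψ →
        (∃ (E : Type (max uY uG)) (_ : NormedAddCommGroup E) (_ : NormedSpace ℂ E)
          (_ : CompleteSpace E) (_ : SMul Bᵐᵒᵖ E) (_ : CStarModule Bᵐᵒᵖ E)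
          (πC : C →⋆ₙₐ[ℂ] HilbertModule.AdjointableEnd Bᵐᵒᵖ E),
          HilbertModule.IsInducedRep Y πψ πC) ∧
        ∀ (E : Type uE) [NormedAddCommGroup E] [NormedSpace ℂ E] [CompleteSpace E]
          [SMul Bᵐᵒᵖ E] [CStarModule Bᵐᵒᵖ E]
          (πC : C →⋆ₙₐ[ℂ] HilbertModule.AdjointableEnd Bᵐᵒᵖ E),
          HilbertModule.IsInducedRep Y πψ πC →
          ∀ (H : Type uH) [NormedAddCommGroup H] [NormedSpace ℂ H] [CompleteSpace H]
            [SMul Bᵐᵒᵖ H] [CStarModule Bᵐᵒᵖ H]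
            (πφ : C →⋆ₙₐ[ℂ] HilbertModule.AdjointableEnd Bᵐᵒᵖ H)
            (Vφ : HilbertModule.adjointable Bᵐᵒᵖ C⋆ᵐᵒᵈ(Bᵐᵒᵖ, Fin n → F) H),
            HilbertModule.IsMinimalKSGNS φ πφ Vφ →
            HilbertModule.UnitarilyEquivalent πφ πC := by
  obtain ⟨G₀, _, _, _, _, _, π₀, V₀, hV₀⟩ := exists_minimalKSGNS ψ
  obtain ⟨E₀, _, _, _, _, _, τ₀, hτ₀⟩ := exists_isInteriorTensorProduct (Y := Y) π₀
  obtain ⟨πC₀, hC₀⟩ := hτ₀.exists_inducedRep hY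
  let φ := conjCP πC₀ (rowMap fun j => adjointableComp (hτ₀.creation (u j)) V₀)
  have hφ : ∀ c x i, (φ c).toCLM x i = ∑ j, (ψ (rightInner D (u i) (c • u j))).toCLM (x j) :=
    hV₀.conj_rowMap_creation_apply hτ₀ hC₀ u
  refine ⟨φ, hφ, ?_, ?_⟩
  -- The module `E₀` also represents `φ` minimally but may lie in the wrong universe, so the
  -- intertwiner is transported to a KSGNS module built from `φ` directly.
  · obtain ⟨H, _, _, _, _, _, πφ, Vφ, hVφ⟩ := exists_minimalKSGNS φ
    obtain ⟨πY, hπY⟩ := (hτ₀.isMoritaIntertwiner hY hC₀).of_unitarilyEquivalent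
      (hVφ.unitarilyEquivalent (hV₀.induced hτ₀ hC₀ hu hφ))
    exact ⟨H, _, _, _, _, _, πφ, Vφ, G₀, _, _, _, _, _, π₀, V₀, hVφ, hV₀, hVφ.isNondegenerate,
      hV₀.isNondegenerate, Y, _, _, _, _, _, _, πY, hY, hπY⟩
  · intro G _ _ _ _ _ πψ Vψ hVψ
    refine ⟨?_, ?_⟩
    · obtain ⟨E, _, _, _, _, _, τ, hτ⟩ := exists_isInteriorTensorProduct (Y := Y) πψ
      obtain ⟨πC, hC⟩ := hτ.exists_inducedRep hY
      exact ⟨E, _, _, ‹_›, _, _, πC, τ, hτ, hC⟩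
    · rintro E _ _ _ _ _ πC ⟨τ, hτ, hC⟩ H _ _ _ _ _ πφ Vφ hVφ
      exact hVφ.unitarilyEquivalent (hVψ.induced hτ hC hu hφ)
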